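/- Let $\rho,\sigma$ be quantum states (positive semidefinite operators of unit trace) on a finite-dimensional Hilbert space. Powers of a positive semidefinite operator are taken on its support (so $\rho^0$ is the projection onto the support of $\rho$), and for a Hermitian operator $X$, $X_+$ denotes its positive part. Put $E_\gamma(\rho\|\sigma)=\operatorname{Tr}(\rho-\gamma\sigma)_+$ and, for $0<\alpha<1$ and $f_\alpha(x)=\frac{x^\alpha-1}{\alpha-1}$, $$H_\alpha(\rho\|\sigma)=\int_1^\infty\Big(f_\alpha''(\gamma)E_\gamma(\rho\|\sigma)+\gamma^{-3}f_\alpha''(\gamma^{-1})E_\gamma(\sigma\|\rho)\Big)\,d\gamma,\qquad \overline H_\alpha(\rho\|\sigma)=\frac{1-\operatorname{Tr}[\rho^\alpha\sigma^{1-\alpha}]}{1-\alpha}.$$ Let $p_e(\rho,\sigma)=1-\frac12\operatorname{Tr}|\rho-\sigma|$ and $C(\rho,\sigma)=-\min_{0\le\alpha\le1}\log\operatorname{Tr}[\rho^\alpha\sigma^{1-\alpha}]\in[0,+\infty]$, with $\log 0=-\infty$. 1. For every $0<\alpha<1$ the integral defining $H_\alpha(\rho\|\sigma)$ converges absolutely,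 and $$(1-\alpha)\overline H_\alpha(\rho\|\sigma)\le(1-\alpha)H_\alpha(\rho\|\sigma)\le E_1(\rho\|\sigma)=\operatorname{Tr}(\rho-\sigma)_+ .$$ The same inequalities hold for $\alpha=0$ and $\alpha=1$, where $(1-\alpha)\overline H_\alpha(\rho\|\sigma)$ and $(1-\alpha)H_\alpha(\rho\|\sigma)$ are understood as their limits from inside $(0,1)$; these limits exist, and the former equals $1-\operatorname{Tr}[\rho^\alpha\sigma^{1-\alpha}]$. 2. This strengthens the inequality $p_e(\rho,\sigma)\le\operatorname{Tr}[\rho^\alpha\sigma^{1-\alpha}]$ ($0\le\alpha\le1$) of Audenaert et al.: for $0<\alpha<1$, $$p_e(\rho,\sigma)\le 1-(1-\alpha)H_\alpha(\rho\|\sigma)\le\operatorname{Tr}[\rho^\alpha\sigma^{1-\alpha}].$$ 3. The minimum in the definition of $C(\rho,\sigma)$ is attained, and for every $n\ge1$ one has the achievability part of the quantum Chernoff bound $$-\frac1n\log p_e\big(\rho^{\otimes n},\sigma^{\otimes n}\big)\ge C(\rho,\sigma).$$ -/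

import Mathlib

open scoped Topology ComplexOrder

noncomputable section

namespace QDiv

variable {d : Type*} [Fintype d] [DecidableEq d]

/-- A quantum state (density matrix) on a finite-dimensional Hilbert space: positive semidefinite
with unit trace. -/
structure IsState (ρ : Matrix d d ℂ) : Prop where
  posSemidef : ρ.PosSemidef
  trace_eq_one : ρ.trace = 1

/-- `Tr X₊`, the trace of the positive part of a Hermitian matrix (functional calculus), i.e. the
sum of its positive eigenvalues. -/
def trPosPart (X : Matrix d d ℂ) : ℝ :=
  (cfc (fun x : ℝ => max x 0) X).trace.re

/-- `Tr |X|` for a Hermitian matrix `X`. -/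
def trAbs (X : Matrix d d ℂ) : ℝ :=
  (cfc (fun x : ℝ => |x|) X).trace.re

/-- The power `A ^ s` of a positive semidefinite matrix, taken on the support of `A`: the
eigenvalue `0` is sent to `0` for every exponent. So `A ^ 0` is the projection onto the support
of `A`; for `s > 0` this is the usual power. -/
def mpow (A : Matrix d d ℂ) (s : ℝ) : Matrix d d ℂ :=
  cfc (fun x : ℝ => if x = 0 then 0 else x ^ s) A

/-- The quantum hockey-stick divergence `E_γ(ρ‖σ) = Tr (ρ - γ σ)₊`. -/
def hockeyStick (γ : ℝ) (ρ σ : Matrix d d ℂ) : ℝ :=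
  trPosPart (ρ - (γ : ℂ) • σ)

/-- The integrand `f''(γ) E_γ(ρ‖σ) + γ⁻³ f''(γ⁻¹) E_γ(σ‖ρ)` of the quantum `f`-divergence. -/
def fDivIntegrand (f : ℝ → ℝ) (ρ σ : Matrix d d ℂ) (γ : ℝ) : ℝ :=
  deriv (deriv f) γ * hockeyStick γ ρ σ
    + γ⁻¹ ^ 3 * deriv (deriv f) γ⁻¹ * hockeyStick γ σ ρ

/-- The quantum `f`-divergence `D_f(ρ‖σ)`, an integral over `γ ∈ (1, ∞)`. Only the values of `f`
on `(0, ∞)` matter. -/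
def fDiv (f : ℝ → ℝ) (ρ σ : Matrix d d ℂ) : ℝ :=
  ∫ γ in Set.Ioi (1 : ℝ), fDivIntegrand f ρ σ γ

/-- `f_α(x) = (x ^ α - 1) / (α - 1)`, for `α ≠ 1`. -/
def hellingerFun (α : ℝ) (x : ℝ) : ℝ :=
  (x ^ α - 1) / (α - 1)

/-- The quantum Hellinger divergence `H_α(ρ‖σ) = D_{f_α}(ρ‖σ)` (`α > 0`, `α ≠ 1`). -/
def hellinger (α : ℝ) (ρ σ : Matrix d d ℂ) : ℝ :=
  fDiv (hellingerFun α) ρ σ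

/-- `Tr[ρ^α σ^(1-α)]`. -/
def petzTrace (α : ℝ) (ρ σ : Matrix d d ℂ) : ℝ :=
  (mpow ρ α * mpow σ (1 - α)).trace.re

/-- The Petz-type Hellinger divergence `(1 - Tr[ρ^α σ^(1-α)]) / (1 - α)` (`α ≠ 1`). -/
def petzHellinger (α : ℝ) (ρ σ : Matrix d d ℂ) : ℝ :=
  1 / (1 - α) * (1 - petzTrace α ρ σ)

/-- `p_e(ρ, σ) = 1 - (1/2) Tr |ρ - σ|`. -/
def errorProb (ρ σ : Matrix d d ℂ) : ℝ :=
  1 - 1 / 2 * trAbs (ρ - σ)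

/-- The `n`-fold tensor power `ρ^{⊗ n}`, in the product basis indexed by `Fin n → d`. -/
def tensorPow (n : ℕ) (ρ : Matrix d d ℂ) : Matrix (Fin n → d) (Fin n → d) ℂ :=
  Matrix.of fun i j => ∏ k, ρ (i k) (j k)

/-- The logarithm of a non-negative real as an extended real, with `log 0 = -∞`. -/
def elog (x : ℝ) : EReal :=
  ENNReal.log (ENNReal.ofReal x)

/-- The quantum Chernoff information `C(ρ, σ) = - min_{0 ≤ α ≤ 1} log Tr[ρ^α σ^(1-α)]`, with
values in the extended reals (it is `+∞` for orthogonal states). -/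
def chernoff (ρ σ : Matrix d d ℂ) : EReal :=
  -⨅ α ∈ Set.Icc (0 : ℝ) 1, elog (petzTrace α ρ σ)

end QDiv

end

/-! The heart of the matter is `1 - (1 - α) H_α ≤ Tr[ρ^α σ^(1-α)]`. Since `f_α''(x) = α x^(α-2)`,
and since `1 - E_γ(σ‖ρ) = γ (1 - E_{1/γ}(ρ‖σ))` folds the second half of the integral onto `(0, 1)`,
this is equivalent to `∫₀^∞ t^(α-2) (Tr ρ - Tr (ρ - tσ)₊) dt ≤ Tr[ρ^α σ^(1-α)] / (α (1 - α))`. For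
commuting states equality holds, by the scalar formula `∫₀^∞ t^(α-2) min(p, tq) dt = p^α q^(1-α) /
(α (1 - α))`.

Let `0 < α ≤ 1/2` and let `σ` be invertible. Then `Tr ρ - Tr (ρ - tσ)₊ = Tr tσ - Tr (tσ - ρ)₊` is
the integral over `u > 0` of the number of eigenvalues of `tσ` above `u` minus that of `tσ - ρ`. By
Sylvester's law of inertia the latter number counts the eigenvalues of `X_u = σ^(-1/2) (ρ + u)
σ^(-1/2)` below `t`. After exchanging the integrals, the one over `t` gives `(u^(α-1) Tr σ^(1-α) -
Tr X_u^(α-1)) / (1 - α)`. The Araki–Lieb–Thirring inequality `araki_lieb_thirring` with exponent `1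
- α` bounds `Tr X_u^(α-1)` below by `Tr[(ρ + u)^(α-1) σ^(1-α)]`, and the integral over `u` produces
`ρ^α / α`. This is `lintegral_trace_min_le_of_pos`. Perturbing `σ` removes invertibility, and
exchanging the states gives `α ≥ 1/2`.

The bound `(1 - α) H_α ≤ E_1` only uses that `E_γ` decreases in `γ`. The endpoints follow by passing
to limits, and the Chernoff bound from the multiplicativity of `Tr[ρ^α σ^(1-α)]` under tensor
powers. -/

namespace QDiv

open Matrix

/-! ### Spectral decompositions, inertia, and the trace of the positive part -/

section Spectral

variable {d : Type*} [Fintype d] [DecidableEq d]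

/-- The matrix `U diag(x) Uᴴ`. -/
noncomputable def spec (U : unitaryGroup d ℂ) (x : d → ℝ) : Matrix d d ℂ :=
  (U : Matrix d d ℂ) * diagonal (fun i => (x i : ℂ)) * (U : Matrix d d ℂ)ᴴ

/-- The squared overlaps `|⟨uᵢ, vⱼ⟩|²` of two orthonormal bases. -/
noncomputable def overlap (U V : unitaryGroup d ℂ) (i j : d) : ℝ :=
  ‖((U : Matrix d d ℂ)ᴴ * (V : Matrix d d ℂ)) i j‖ ^ 2

lemma conjTranspose_mul_unitary (U : unitaryGroup d ℂ) :
    (U : Matrix d d ℂ)ᴴ * (U : Matrix d d ℂ) = 1 := Unitary.star_mul_self_of_mem U.2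

lemma unitary_mul_conjTranspose (U : unitaryGroup d ℂ) :
    (U : Matrix d d ℂ) * (U : Matrix d d ℂ)ᴴ = 1 := Unitary.mul_star_self_of_mem U.2

lemma overlap_nonneg (U V : unitaryGroup d ℂ) (i j : d) : 0 ≤ overlap U V i j := by
  unfold overlap; positivity

lemma sum_normSq_row (U : unitaryGroup d ℂ) (i : d) :
    ∑ j, ‖(U : Matrix d d ℂ) i j‖ ^ 2 = 1 := by
  have h := congrFun (congrFun (unitary_mul_conjTranspose U) i) i
  simp only [Matrix.mul_apply, conjTranspose_apply, one_apply_eq, Complex.star_def,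
    Complex.mul_conj'] at h
  exact_mod_cast h

lemma sum_normSq_col (U : unitaryGroup d ℂ) (j : d) :
    ∑ i, ‖(U : Matrix d d ℂ) i j‖ ^ 2 = 1 := by
  have h := congrFun (congrFun (conjTranspose_mul_unitary U) j) j
  simp only [Matrix.mul_apply, conjTranspose_apply, one_apply_eq, Complex.star_def,
    Complex.conj_mul'] at h
  exact_mod_cast h

lemma overlap_eq (U V : unitaryGroup d ℂ) (i j : d) :
    overlap U V i j = ‖((star U * V : unitaryGroup d ℂ) : Matrix d d ℂ) i j‖ ^ 2 := rfl

lemma sum_overlap_col (U V : unitaryGroup d ℂ) (j : d) : ∑ i, overlap U V i j = 1 := by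
  simp_rw [overlap_eq]; exact sum_normSq_col _ j

lemma overlap_comm (U V : unitaryGroup d ℂ) (i j : d) : overlap U V i j = overlap V U j i := by
  have : (U : Matrix d d ℂ)ᴴ * (V : Matrix d d ℂ) = ((V : Matrix d d ℂ)ᴴ * (U : Matrix d d ℂ))ᴴ := by
    simp [conjTranspose_mul]
  unfold overlap
  rw [this, conjTranspose_apply, norm_star]

lemma spec_isHermitian (U : unitaryGroup d ℂ) (x : d → ℝ) : (spec U x).IsHermitian := by
  unfold spec
  rw [IsHermitian, conjTranspose_mul, conjTranspose_mul, diagonal_conjTranspose,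
    conjTranspose_conjTranspose, mul_assoc]
  congr! 3
  ext i; simp

lemma spec_mul_spec (U : unitaryGroup d ℂ) (x y : d → ℝ) :
    spec U x * spec U y = spec U (fun i => x i * y i) := by
  unfold spec
  calc _ = (U : Matrix d d ℂ) * diagonal (fun i => (x i : ℂ)) *
        ((U : Matrix d d ℂ)ᴴ * (U : Matrix d d ℂ)) * diagonal (fun i => (y i : ℂ)) *
          (U : Matrix d d ℂ)ᴴ := by simp only [mul_assoc]
    _ = _ := by
      rw [conjTranspose_mul_unitary, mul_one, mul_assoc (U : Matrix d d ℂ), diagonal_mul_diagonal]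
      simp

lemma spec_add (U : unitaryGroup d ℂ) (x y : d → ℝ) :
    spec U x + spec U y = spec U (fun i => x i + y i) := by
  unfold spec
  rw [← add_mul, ← mul_add, diagonal_add]; simp

lemma spec_smul (U : unitaryGroup d ℂ) (x : d → ℝ) (c : ℝ) :
    (c : ℂ) • spec U x = spec U (fun i => c * x i) := by
  unfold spec
  rw [← smul_mul_assoc, ← mul_smul_comm, ← diagonal_smul]
  congr! 3; ext i; simp

lemma spec_const (U : unitaryGroup d ℂ) (c : ℝ) :
    spec U (fun _ => c) = (c : ℂ) • (1 : Matrix d d ℂ) := by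
  unfold spec
  rw [← smul_one_eq_diagonal, mul_smul_comm, smul_mul_assoc, mul_one, unitary_mul_conjTranspose]

lemma spec_sub (U : unitaryGroup d ℂ) (x y : d → ℝ) :
    spec U x - spec U y = spec U (fun i => x i - y i) := by
  rw [sub_eq_iff_eq_add, spec_add]; simp

lemma spec_neg (U : unitaryGroup d ℂ) (x : d → ℝ) : -spec U x = spec U (fun i => -x i) := by
  have := spec_smul U x (-1)
  simpa using this

lemma trace_spec (U : unitaryGroup d ℂ) (x : d → ℝ) : (spec U x).trace.re = ∑ i, x i := by
  unfold spec
  rw [trace_mul_comm, ← mul_assoc, conjTranspose_mul_unitary, one_mul, trace_diagonal]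
  simp

lemma IsHermitian.exists_spec {A : Matrix d d ℂ} (hA : A.IsHermitian) :
    ∃ (U : unitaryGroup d ℂ) (x : d → ℝ), A = spec U x := by
  refine ⟨hA.eigenvectorUnitary, hA.eigenvalues, ?_⟩
  conv_lhs => rw [hA.spectral_theorem]
  rfl

lemma PosDef.exists_spec {A : Matrix d d ℂ} (hA : A.PosDef) :
    ∃ (U : unitaryGroup d ℂ) (x : d → ℝ), (∀ i, 0 < x i) ∧ A = spec U x := by
  refine ⟨hA.1.eigenvectorUnitary, hA.1.eigenvalues, hA.eigenvalues_pos, ?_⟩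
  conv_lhs => rw [hA.1.spectral_theorem]
  rfl

lemma PosSemidef.exists_spec {A : Matrix d d ℂ} (hA : A.PosSemidef) :
    ∃ (U : unitaryGroup d ℂ) (x : d → ℝ), (∀ i, 0 ≤ x i) ∧ A = spec U x := by
  refine ⟨hA.1.eigenvectorUnitary, hA.1.eigenvalues, hA.eigenvalues_nonneg, ?_⟩
  conv_lhs => rw [hA.1.spectral_theorem]
  rfl

lemma spec_posSemidef (U : unitaryGroup d ℂ) {x : d → ℝ} (hx : ∀ i, 0 ≤ x i) :
    (spec U x).PosSemidef := by
  have : (diagonal (fun i => (x i : ℂ))).PosSemidef :=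
    PosSemidef.diagonal fun i => by simpa using hx i
  exact this.mul_mul_conjTranspose_same _

/-- The functional calculus does not depend on the chosen eigenbasis: the change of basis `G`
intertwines the two diagonal matrices, so it only links equal eigenvalues and also intertwines their
images under `f`. Arbitrary diagonalizations may thus be used throughout. -/
lemma cfc_spec (f : ℝ → ℝ) (U : unitaryGroup d ℂ) (x : d → ℝ) :
    cfc f (spec U x) = spec U (fun i => f (x i)) := by
  have hA := spec_isHermitian U x
  set W := hA.eigenvectorUnitary
  set y := hA.eigenvalues
  have h1 : spec U x = spec W y := by
    conv_lhs => rw [hA.spectral_theorem]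
    rfl
  have h2 : cfc f (spec U x) = spec W (fun i => f (y i)) := by
    rw [hA.cfc_eq]; rfl
  rw [h2]
  set G : Matrix d d ℂ := (W : Matrix d d ℂ)ᴴ * U with hG
  have key : diagonal (fun i => (y i : ℂ)) * G = G * diagonal (fun i => (x i : ℂ)) := by
    have := congrArg (fun Z => (W : Matrix d d ℂ)ᴴ * Z * U) h1
    simp only [spec] at this
    calc diagonal (fun i => (y i : ℂ)) * G
        = ((W : Matrix d d ℂ)ᴴ * W) * diagonal (fun i => (y i : ℂ)) * (W : Matrix d d ℂ)ᴴ * U := by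
          rw [conjTranspose_mul_unitary, one_mul, hG, mul_assoc]
      _ = (W : Matrix d d ℂ)ᴴ * U * diagonal (fun i => (x i : ℂ)) * ((U : Matrix d d ℂ)ᴴ * U) := by
          simp only [mul_assoc] at this ⊢
          exact this.symm
      _ = _ := by rw [conjTranspose_mul_unitary, mul_one]
  have key2 : diagonal (fun i => (f (y i) : ℂ)) * G = G * diagonal (fun i => (f (x i) : ℂ)) := by
    ext i j
    have := congrFun (congrFun key i) j
    simp only [diagonal_mul, mul_diagonal] at this ⊢
    by_cases h0 : G i j = 0
    · simp [h0]
    · have hxy : (y i : ℂ) = x j := mul_right_cancel₀ h0 (by rw [this, mul_comm])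
      have hxy' : y i = x j := by exact_mod_cast hxy
      rw [hxy', mul_comm]
  unfold spec
  calc (W : Matrix d d ℂ) * diagonal (fun i => (f (y i) : ℂ)) * (W : Matrix d d ℂ)ᴴ
      = W * (diagonal (fun i => (f (y i) : ℂ)) * G) * (U : Matrix d d ℂ)ᴴ := by
        rw [hG]; simp only [mul_assoc, unitary_mul_conjTranspose, mul_one]
    _ = (W * (W : Matrix d d ℂ)ᴴ) * U * diagonal (fun i => (f (x i) : ℂ)) *
          (U : Matrix d d ℂ)ᴴ := by
        rw [key2, hG]; simp only [mul_assoc]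
    _ = _ := by rw [unitary_mul_conjTranspose, one_mul]

lemma trPosPart_spec (U : unitaryGroup d ℂ) (x : d → ℝ) :
    trPosPart (spec U x) = ∑ i, max (x i) 0 := by
  rw [trPosPart, cfc_spec, trace_spec]

lemma trAbs_spec (U : unitaryGroup d ℂ) (x : d → ℝ) :
    trAbs (spec U x) = ∑ i, |x i| := by
  rw [trAbs, cfc_spec, trace_spec]

lemma mpow_spec (U : unitaryGroup d ℂ) (x : d → ℝ) (s : ℝ) :
    mpow (spec U x) s = spec U (fun i => if x i = 0 then 0 else x i ^ s) := by
  rw [mpow, cfc_spec]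

lemma trace_spec_mul_spec (U V : unitaryGroup d ℂ) (x y : d → ℝ) :
    (spec U x * spec V y).trace.re = ∑ i, ∑ j, x i * y j * overlap U V i j := by
  have : (spec U x * spec V y).trace = (diagonal (fun i => (x i : ℂ)) *
      ((U : Matrix d d ℂ)ᴴ * (V : Matrix d d ℂ)) * diagonal (fun i => (y i : ℂ)) *
        ((U : Matrix d d ℂ)ᴴ * (V : Matrix d d ℂ))ᴴ).trace := by
    unfold spec
    rw [conjTranspose_mul, conjTranspose_conjTranspose, mul_assoc (U : Matrix d d ℂ), mul_assoc,
      trace_mul_comm]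
    simp only [mul_assoc]
  rw [this]
  simp only [overlap]
  generalize (U : Matrix d d ℂ)ᴴ * (V : Matrix d d ℂ) = G
  rw [trace, Complex.re_sum]
  simp only [diag, Matrix.mul_apply (N := Gᴴ), mul_diagonal, diagonal_mul, conjTranspose_apply,
    Complex.re_sum]
  refine Finset.sum_congr rfl fun i _ => Finset.sum_congr rfl fun j _ => ?_
  rw [show (x i : ℂ) * G i j * (y j : ℂ) * star (G i j) = x i * y j * (G i j * star (G i j)) by ring,
    Complex.star_def, Complex.mul_conj',
    ← Complex.ofReal_pow, ← Complex.ofReal_mul, ← Complex.ofReal_mul, Complex.ofReal_re]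

lemma petzTrace_spec (U V : unitaryGroup d ℂ) (a b : d → ℝ) (α : ℝ) :
    petzTrace α (spec U a) (spec V b) =
      ∑ i, ∑ j, (if a i = 0 then 0 else a i ^ α) * (if b j = 0 then 0 else b j ^ (1 - α)) *
        overlap U V i j := by
  rw [petzTrace, mpow_spec, mpow_spec, trace_spec_mul_spec]

/-- The quadratic form of `spec U x` in the eigenbasis. -/
lemma re_dotProduct_spec (U : unitaryGroup d ℂ) (x : d → ℝ) (v : d → ℂ) :
    (star v ⬝ᵥ (spec U x *ᵥ v)).re = ∑ i, x i * ‖((U : Matrix d d ℂ)ᴴ *ᵥ v) i‖ ^ 2 := by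
  have : star v ⬝ᵥ (spec U x *ᵥ v) = star ((U : Matrix d d ℂ)ᴴ *ᵥ v) ⬝ᵥ
      (diagonal (fun i => (x i : ℂ)) *ᵥ ((U : Matrix d d ℂ)ᴴ *ᵥ v)) := by
    unfold spec
    rw [star_mulVec, conjTranspose_conjTranspose, ← dotProduct_mulVec, mulVec_mulVec,
      mulVec_mulVec, mul_assoc]
  rw [this]
  simp only [dotProduct, mulVec_diagonal, Complex.re_sum, Pi.star_apply]
  refine Finset.sum_congr rfl fun i _ => ?_
  rw [mul_left_comm, Complex.star_def, Complex.conj_mul',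
    ← Complex.ofReal_pow, ← Complex.ofReal_mul, Complex.ofReal_re]

/-- Inertia comparison: if `⟨v, A v⟩ ≤ ⟨S v, B S v⟩` for all `v`, then `B` has at least as many
positive eigenvalues as `A`. -/
lemma card_pos_le_card_pos (U V : unitaryGroup d ℂ) (x y : d → ℝ) (S : Matrix d d ℂ)
    (h : ∀ v, (star v ⬝ᵥ (spec U x *ᵥ v)).re ≤
      (star (S *ᵥ v) ⬝ᵥ (spec V y *ᵥ (S *ᵥ v))).re) :
    (Finset.univ.filter fun i => 0 < x i).card ≤ (Finset.univ.filter fun j => 0 < y j).card := by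
  by_contra! hlt
  set P := {i // 0 < x i}
  set Q := {j // 0 < y j}
  let ι : (P → ℂ) →ₗ[ℂ] (d → ℂ) := Function.ExtendByZero.linearMap ℂ Subtype.val
  -- `L` takes a combination of positive eigenvectors of the first matrix, applies `S`, and reads
  -- off the components along the positive eigenvectors of the second. If the second has fewer of
  -- these, a kernel vector makes the first form positive and the second nonpositive.
  let L : (P → ℂ) →ₗ[ℂ] (Q → ℂ) :=
    LinearMap.funLeft ℂ ℂ Subtype.val ∘ₗ
      Matrix.toLin' ((V : Matrix d d ℂ)ᴴ * S * (U : Matrix d d ℂ)) ∘ₗ ι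
  have hker : ∃ c ∈ LinearMap.ker L, c ≠ 0 := by
    apply Submodule.exists_mem_ne_zero_of_ne_bot
    apply LinearMap.ker_ne_bot_of_finrank_lt
    simpa [P, Q, Fintype.card_subtype] using hlt
  obtain ⟨c, hc, hc0⟩ := hker
  have hz : ∀ i, ι c i = if hi : 0 < x i then c ⟨i, hi⟩ else 0 := by
    intro i
    by_cases hi : 0 < x i
    · simp only [hi, dite_true]
      exact Function.Injective.extend_apply Subtype.val_injective c 0 ⟨i, hi⟩
    · simp only [hi, dite_false]
      exact Function.extend_apply' _ _ _ (by rintro ⟨a, rfl⟩; exact hi a.2)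
  set v := (U : Matrix d d ℂ) *ᵥ ι c
  have hv : (U : Matrix d d ℂ)ᴴ *ᵥ v = ι c := by
    simp [v, mulVec_mulVec, conjTranspose_mul_unitary]
  have h1 : 0 < (star v ⬝ᵥ (spec U x *ᵥ v)).re := by
    rw [re_dotProduct_spec, hv]
    obtain ⟨p, hp⟩ := Function.ne_iff.mp hc0
    apply Finset.sum_pos'
    · intro i _
      rw [hz]
      split_ifs with hi
      · positivity
      · simp
    · refine ⟨p.1, Finset.mem_univ _, ?_⟩
      rw [hz, dif_pos p.2]
      have : 0 < ‖c p‖ := norm_pos_iff.mpr hp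
      have := p.2
      positivity
  have h2 : (star (S *ᵥ v) ⬝ᵥ (spec V y *ᵥ (S *ᵥ v))).re ≤ 0 := by
    rw [re_dotProduct_spec]
    apply Finset.sum_nonpos
    intro j _
    by_cases hj : 0 < y j
    · have := congrFun (LinearMap.mem_ker.mp hc) ⟨j, hj⟩
      simp only [L, LinearMap.comp_apply, LinearMap.funLeft_apply, Matrix.toLin'_apply,
        Pi.zero_apply] at this
      have h3 : ((V : Matrix d d ℂ)ᴴ *ᵥ (S *ᵥ v)) j = 0 := by
        simpa only [v, mulVec_mulVec, mul_assoc] using this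
      simp [h3]
    · exact mul_nonpos_of_nonpos_of_nonneg (not_lt.mp hj) (by positivity)
  linarith [h v]

/-- In the eigenbasis of `A`, each eigenvalue of `A` is at most the corresponding diagonal entry of
`B`, an average of the eigenvalues of `B` with the overlaps as weights. Take positive parts and sum,
using that the overlaps also add up to one over the basis of `A`. -/
lemma trPosPart_mono {A B : Matrix d d ℂ} (hA : A.IsHermitian) (hAB : (B - A).PosSemidef) :
    trPosPart A ≤ trPosPart B := by
  have hB : B.IsHermitian := by simpa using hAB.1.add hA
  obtain ⟨U, x, hU⟩ := IsHermitian.exists_spec hA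
  obtain ⟨V, y, hV⟩ := IsHermitian.exists_spec hB
  have hx : ∀ i, x i ≤ ∑ j, overlap U V i j * y j := by
    intro i
    set v := (U : Matrix d d ℂ) *ᵥ Pi.single i 1
    have hv : (U : Matrix d d ℂ)ᴴ *ᵥ v = Pi.single i 1 := by
      simp only [v, mulVec_mulVec, conjTranspose_mul_unitary, one_mulVec]
    have h1 : (star v ⬝ᵥ (A *ᵥ v)).re = x i := by
      rw [hU, re_dotProduct_spec, hv, Finset.sum_eq_single i] <;> simp +contextual
    have h2 : (star v ⬝ᵥ (B *ᵥ v)).re = ∑ j, overlap U V i j * y j := by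
      rw [hV, re_dotProduct_spec]
      refine Finset.sum_congr rfl fun j _ => ?_
      rw [overlap_comm, overlap, mul_comm]
      rw [show (V : Matrix d d ℂ)ᴴ *ᵥ v = ((V : Matrix d d ℂ)ᴴ * (U : Matrix d d ℂ)) *ᵥ Pi.single i 1
        by simp only [v, mulVec_mulVec], mulVec_single_one, col_apply]
    have h3 := hAB.re_dotProduct_nonneg v
    rw [sub_mulVec, dotProduct_sub] at h3
    simp only [map_sub, RCLike.re_to_complex] at h3
    linarith
  rw [hU, hV, trPosPart_spec, trPosPart_spec]
  calc ∑ i, max (x i) 0 ≤ ∑ i, ∑ j, overlap U V i j * max (y j) 0 := by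
        refine Finset.sum_le_sum fun i _ => max_le ((hx i).trans ?_) ?_
        · exact Finset.sum_le_sum fun j _ =>
            mul_le_mul_of_nonneg_left (le_max_left _ _) (overlap_nonneg _ _ _ _)
        · exact Finset.sum_nonneg fun j _ => mul_nonneg (overlap_nonneg _ _ _ _) (le_max_right _ _)
    _ = ∑ j, max (y j) 0 := by
        rw [Finset.sum_comm]
        refine Finset.sum_congr rfl fun j _ => ?_
        rw [← Finset.sum_mul, sum_overlap_col, one_mul]

lemma trPosPart_nonneg {A : Matrix d d ℂ} (hA : A.IsHermitian) : 0 ≤ trPosPart A := by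
  obtain ⟨U, x, rfl⟩ := IsHermitian.exists_spec hA
  rw [trPosPart_spec]
  exact Finset.sum_nonneg fun j _ => le_max_right _ _

lemma trPosPart_neg {A : Matrix d d ℂ} (hA : A.IsHermitian) :
    trPosPart (-A) = trPosPart A - A.trace.re := by
  obtain ⟨U, x, rfl⟩ := IsHermitian.exists_spec hA
  rw [spec_neg, trPosPart_spec, trPosPart_spec, trace_spec, ← Finset.sum_sub_distrib]
  refine Finset.sum_congr rfl fun i _ => ?_
  rcases le_total (x i) 0 with h | h
  · rw [max_eq_left (by linarith), max_eq_right h]; ring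
  · rw [max_eq_right (by linarith), max_eq_left h]; ring

lemma trPosPart_smul {A : Matrix d d ℂ} (hA : A.IsHermitian) {c : ℝ} (hc : 0 ≤ c) :
    trPosPart ((c : ℂ) • A) = c * trPosPart A := by
  obtain ⟨U, x, rfl⟩ := IsHermitian.exists_spec hA
  rw [spec_smul, trPosPart_spec, trPosPart_spec, Finset.mul_sum]
  refine Finset.sum_congr rfl fun i _ => ?_
  rw [mul_max_of_nonneg _ _ hc, mul_zero]

lemma trAbs_eq {A : Matrix d d ℂ} (hA : A.IsHermitian) :
    trAbs A = 2 * trPosPart A - A.trace.re := by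
  obtain ⟨U, x, rfl⟩ := IsHermitian.exists_spec hA
  rw [trAbs_spec, trPosPart_spec, trace_spec, Finset.mul_sum, ← Finset.sum_sub_distrib]
  refine Finset.sum_congr rfl fun i _ => ?_
  rcases le_total (x i) 0 with h | h
  · rw [abs_of_nonpos h, max_eq_right h]; ring
  · rw [abs_of_nonneg h, max_eq_left h]; ring

end Spectral

end QDiv

namespace QDiv

open Matrix

/-! ### The Araki–Lieb–Thirring inequality by complex interpolation -/

section ArakiLiebThirring

variable {d : Type*} [Fintype d] [DecidableEq d]

/-- The weights `(|G i j|² + |H j i|²) / 2` form a doubly stochastic matrix dominating `|G i j| |H j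
i|`, so summing `p i + q j` against them leaves the plain sums. It plays the role of Hölder's
inequality on both edges of the strip. -/
lemma norm_trace_diagonal_mul_le (G H : unitaryGroup d ℂ) (s t : d → ℂ) (p q : d → ℝ)
    (h : ∀ i j, ‖s i‖ * ‖t j‖ ≤ p i + q j) :
    ‖(diagonal s * (G : Matrix d d ℂ) * diagonal t * (H : Matrix d d ℂ)).trace‖ ≤
      ∑ i, p i + ∑ j, q j := by
  have h1 : (diagonal s * (G : Matrix d d ℂ) * diagonal t * (H : Matrix d d ℂ)).trace =
      ∑ i, ∑ j, s i * (G : Matrix d d ℂ) i j * t j * (H : Matrix d d ℂ) j i := by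
    rw [trace]
    simp only [diag, Matrix.mul_apply (N := (H : Matrix d d ℂ)), mul_diagonal, diagonal_mul]
  have h2 : ∀ i j, ‖s i * (G : Matrix d d ℂ) i j * t j * (H : Matrix d d ℂ) j i‖ ≤
      (p i + q j) * ((‖(G : Matrix d d ℂ) i j‖ ^ 2 + ‖(H : Matrix d d ℂ) j i‖ ^ 2) / 2) := by
    intro i j
    rw [norm_mul, norm_mul, norm_mul]
    calc _ = (‖s i‖ * ‖t j‖) * (‖(G : Matrix d d ℂ) i j‖ * ‖(H : Matrix d d ℂ) j i‖) := by ring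
      _ ≤ _ := by
        apply mul_le_mul (h i j) _ (by positivity) ((by positivity : 0 ≤ ‖s i‖ * ‖t j‖).trans (h i j))
        have := two_mul_le_add_sq ‖(G : Matrix d d ℂ) i j‖ ‖(H : Matrix d d ℂ) j i‖
        linarith
  have h3 : ∑ i, ∑ j, p i * ((‖(G : Matrix d d ℂ) i j‖ ^ 2 + ‖(H : Matrix d d ℂ) j i‖ ^ 2) / 2)
      = ∑ i, p i := by
    refine Finset.sum_congr rfl fun i _ => ?_
    rw [← Finset.mul_sum, ← Finset.sum_div, Finset.sum_add_distrib, sum_normSq_row,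
      sum_normSq_col]
    ring
  have h4 : ∑ i, ∑ j, q j * ((‖(G : Matrix d d ℂ) i j‖ ^ 2 + ‖(H : Matrix d d ℂ) j i‖ ^ 2) / 2)
      = ∑ j, q j := by
    rw [Finset.sum_comm]
    refine Finset.sum_congr rfl fun i _ => ?_
    rw [← Finset.mul_sum, ← Finset.sum_div, Finset.sum_add_distrib, sum_normSq_row,
      sum_normSq_col]
    ring
  rw [h1, ← h3, ← h4, ← Finset.sum_add_distrib]
  refine (norm_sum_le _ _).trans (Finset.sum_le_sum fun i _ => ?_)
  rw [← Finset.sum_add_distrib]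
  refine (norm_sum_le _ _).trans (Finset.sum_le_sum fun j _ => ?_)
  rw [← add_mul]
  exact h2 i j

/-- Singular value decomposition of an invertible matrix. -/
lemma exists_svd (M : Matrix d d ℂ) (W : unitaryGroup d ℂ) (q : d → ℝ) (hq : ∀ i, 0 < q i)
    (hM : Mᴴ * M = spec W q) :
    ∃ Z : unitaryGroup d ℂ, M = (Z : Matrix d d ℂ) * diagonal (fun i => (√(q i) : ℂ)) *
      (W : Matrix d d ℂ)ᴴ := by
  set Z : Matrix d d ℂ := M * (W : Matrix d d ℂ) * diagonal (fun i => ((√(q i))⁻¹ : ℂ)) with hZ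
  have hsq : ∀ i, (√(q i) : ℂ) ≠ 0 := fun i => by
    exact_mod_cast (Real.sqrt_pos.mpr (hq i)).ne'
  have hZu : Zᴴ * Z = 1 := by
    have h1 : (diagonal (fun i => ((√(q i))⁻¹ : ℂ)))ᴴ = diagonal (fun i => ((√(q i))⁻¹ : ℂ)) := by
      rw [diagonal_conjTranspose]; congr 1; ext i; simp
    calc Zᴴ * Z = diagonal (fun i => ((√(q i))⁻¹ : ℂ)) * ((W : Matrix d d ℂ)ᴴ * (Mᴴ * M) *
          (W : Matrix d d ℂ)) * diagonal (fun i => ((√(q i))⁻¹ : ℂ)) := by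
          rw [hZ, conjTranspose_mul, conjTranspose_mul, h1]; simp only [mul_assoc]
      _ = diagonal (fun i => ((√(q i))⁻¹ : ℂ)) * diagonal (fun i => (q i : ℂ)) *
            diagonal (fun i => ((√(q i))⁻¹ : ℂ)) := by
          rw [hM, spec]
          congr 2
          simp only [← mul_assoc, conjTranspose_mul_unitary, one_mul]
          rw [mul_assoc, conjTranspose_mul_unitary, mul_one]
      _ = 1 := by
          rw [diagonal_mul_diagonal, diagonal_mul_diagonal, ← diagonal_one]
          congr 1
          ext i
          have : (q i : ℂ) = √(q i) * √(q i) := by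
            exact_mod_cast (Real.mul_self_sqrt (hq i).le).symm
          rw [this]
          field_simp [hsq i]
  refine ⟨⟨Z, mem_unitaryGroup_iff'.mpr hZu⟩, ?_⟩
  simp only [hZ]
  rw [mul_assoc (M * _), diagonal_mul_diagonal]
  have : (fun i => ((√(q i))⁻¹ : ℂ) * √(q i)) = fun _ => 1 := by
    ext i; exact inv_mul_cancel₀ (hsq i)
  rw [this, diagonal_one, mul_one, mul_assoc, unitary_mul_conjTranspose, mul_one]

/-- A diagonal matrix of phases is unitary. -/
lemma diagonal_mem_unitaryGroup (s : d → ℂ) (hs : ∀ i, ‖s i‖ = 1) :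
    diagonal s ∈ unitaryGroup d ℂ := by
  rw [mem_unitaryGroup_iff', star_eq_conjTranspose, diagonal_conjTranspose, diagonal_mul_diagonal,
    ← diagonal_one]
  congr 1
  ext i
  simp [Complex.conj_mul', hs i]

/-- Hadamard's three lines theorem for `z ↦ Tr[a^{z/2} G b^{z/2} H t^{2-z/r} K]`. -/
lemma norm_trace_interpolation (G H K : Matrix d d ℂ) (a b t : d → ℝ) (ha : ∀ i, 0 < a i)
    (hb : ∀ i, 0 < b i) (ht : ∀ i, 0 < t i) {r : ℝ} (hr0 : 0 < r) (hr1 : r ≤ 1)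
    (f : ℂ → ℂ) (hf : f = fun z : ℂ => (diagonal (fun i => (a i : ℂ) ^ (z / 2)) * G *
      diagonal (fun i => (b i : ℂ) ^ (z / 2)) * H *
        diagonal (fun i => (t i : ℂ) ^ (2 - z / r)) * K).trace)
    {A B : ℝ} (h0 : ∀ y : ℝ, ‖f (y * Complex.I)‖ ≤ A) (h1 : ∀ y : ℝ, ‖f (1 + y * Complex.I)‖ ≤ B) :
    ‖f r‖ ≤ A ^ (1 - r) * B ^ r := by
  have hexp : f = fun z : ℂ => ∑ i, ∑ k, ∑ j, (a i : ℂ) ^ (z / 2) * G i j * (b j : ℂ) ^ (z / 2) *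
      H j k * (t k : ℂ) ^ (2 - z / r) * K k i := by
    rw [hf]
    ext z
    rw [trace]
    simp only [diag, Matrix.mul_apply (N := K), mul_diagonal, Matrix.mul_apply (N := H), diagonal_mul,
      Finset.sum_mul]
  have ha' : ∀ i, (a i : ℂ) ≠ 0 := fun i => by exact_mod_cast (ha i).ne'
  have hb' : ∀ i, (b i : ℂ) ≠ 0 := fun i => by exact_mod_cast (hb i).ne'
  have ht' : ∀ i, (t i : ℂ) ≠ 0 := fun i => by exact_mod_cast (ht i).ne'
  have hdiff : Differentiable ℂ f := by
    rw [hexp]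
    refine Differentiable.fun_sum fun i _ => Differentiable.fun_sum fun k _ =>
      Differentiable.fun_sum fun j _ => ?_
    have e1 : Differentiable ℂ fun z : ℂ => (a i : ℂ) ^ (z / 2) :=
      (differentiable_id.div_const 2).const_cpow (Or.inl (ha' i))
    have e2 : Differentiable ℂ fun z : ℂ => (b j : ℂ) ^ (z / 2) :=
      (differentiable_id.div_const 2).const_cpow (Or.inl (hb' j))
    have e3 : Differentiable ℂ fun z : ℂ => (t k : ℂ) ^ (2 - z / r) :=
      ((differentiable_const 2).sub (differentiable_id.div_const _)).const_cpow (Or.inl (ht' k))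
    exact ((((e1.mul_const _).mul e2).mul_const _).mul e3).mul_const _
  have hbd : BddAbove ((norm ∘ f) '' Complex.HadamardThreeLines.verticalClosedStrip 0 1) := by
    -- The modulus of each term depends on `z` only through its real part, so boundedness on the
    -- strip reduces to compactness of `[0, 1]`.
    let φ : ℝ → ℝ := fun x => ∑ i, ∑ k, ∑ j, a i ^ (x / 2) * ‖G i j‖ * b j ^ (x / 2) *
      ‖H j k‖ * t k ^ (2 - x / r) * ‖K k i‖
    have hφ : Continuous φ := by
      refine continuous_finsetSum _ fun i _ => continuous_finsetSum _ fun k _ =>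
        continuous_finsetSum _ fun j _ => ?_
      have e1 : Continuous fun x : ℝ => a i ^ (x / 2) :=
        Continuous.rpow continuous_const (by fun_prop) fun _ => Or.inl (ha i).ne'
      have e2 : Continuous fun x : ℝ => b j ^ (x / 2) :=
        Continuous.rpow continuous_const (by fun_prop) fun _ => Or.inl (hb j).ne'
      have e3 : Continuous fun x : ℝ => t k ^ (2 - x / r) :=
        Continuous.rpow continuous_const (by fun_prop) fun _ => Or.inl (ht k).ne'
      fun_prop
    obtain ⟨C, hC⟩ := (isCompact_Icc (a := (0 : ℝ)) (b := 1)).bddAbove_image hφ.continuousOn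
    refine ⟨C, ?_⟩
    rintro _ ⟨z, hz, rfl⟩
    refine le_trans ?_ (hC ⟨z.re, hz, rfl⟩)
    simp only [Function.comp, hexp, φ]
    refine (norm_sum_le _ _).trans (Finset.sum_le_sum fun i _ => ?_)
    refine (norm_sum_le _ _).trans (Finset.sum_le_sum fun k _ => ?_)
    refine (norm_sum_le _ _).trans (Finset.sum_le_sum fun j _ => ?_)
    simp only [norm_mul, Complex.norm_cpow_eq_rpow_re_of_pos (ha _),
      Complex.norm_cpow_eq_rpow_re_of_pos (hb _), Complex.norm_cpow_eq_rpow_re_of_pos (ht _)]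
    simp
  have := Complex.HadamardThreeLines.norm_le_interp_of_mem_verticalClosedStrip₀₁' f (z := r)
    (a := A) (b := B) ⟨by simpa using hr0.le, by simpa using hr1⟩ hdiff.diffContOnCl hbd
    (fun z hz => by
      have : z = z.im * Complex.I := by
        apply Complex.ext <;> simp; simpa using hz
      rw [this]; exact h0 _)
    (fun z hz => by
      have : z = 1 + z.im * Complex.I := by
        apply Complex.ext <;> simp; simpa using hz
      rw [this]; exact h1 _)
  simpa using this

lemma spec_mul_spec_inv (U : unitaryGroup d ℂ) {x : d → ℝ} (hx : ∀ i, 0 < x i) :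
    spec U x * spec U (fun i => (x i)⁻¹) = 1 := by
  rw [spec_mul_spec]
  have : (fun i => x i * (x i)⁻¹) = fun _ => 1 := by
    ext i; exact mul_inv_cancel₀ (hx i).ne'
  rw [this, spec_const]; simp

lemma conjTranspose_mul_self_posDef {M N : Matrix d d ℂ} (h : N * M = 1) :
    (Mᴴ * M).PosDef := by
  apply PosDef.conjTranspose_mul_self
  intro v w hvw
  have := congrArg (fun u => N *ᵥ u) hvw
  simpa [mulVec_mulVec, h] using this

lemma coe_star_eq (U : unitaryGroup d ℂ) :
    ((star U : unitaryGroup d ℂ) : Matrix d d ℂ) = (U : Matrix d d ℂ)ᴴ := rfl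

lemma coe_star_mul (U V : unitaryGroup d ℂ) :
    ((star U * V : unitaryGroup d ℂ) : Matrix d d ℂ) =
      (U : Matrix d d ℂ)ᴴ * (V : Matrix d d ℂ) := rfl

/-- Bookkeeping for the edge `Re z = 1`: the square roots are pulled together and replaced by the
singular value decomposition of their product. Once the remaining factors are unitary, only the
diagonals `Q` and `Dt` matter. -/
lemma trace_cycle_of_eq (U V Z : unitaryGroup d ℂ) (A B Q W W' Y Da Db Dt : Matrix d d ℂ)
    (h : (U : Matrix d d ℂ) * A * (U : Matrix d d ℂ)ᴴ *
      ((V : Matrix d d ℂ) * B * (V : Matrix d d ℂ)ᴴ) = (Z : Matrix d d ℂ) * Q * Wᴴ) :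
    (Da * A * ((U : Matrix d d ℂ)ᴴ * (V : Matrix d d ℂ)) * (B * Db) *
      ((V : Matrix d d ℂ)ᴴ * W') * Dt * (Y * (U : Matrix d d ℂ))).trace =
    (Q * (Wᴴ * (V : Matrix d d ℂ) * Db * ((V : Matrix d d ℂ)ᴴ * W')) * Dt *
      (Y * (U : Matrix d d ℂ) * Da * ((U : Matrix d d ℂ)ᴴ * (Z : Matrix d d ℂ)))).trace := by
  have h' : A * ((U : Matrix d d ℂ)ᴴ * (V : Matrix d d ℂ)) * B =
      (U : Matrix d d ℂ)ᴴ * (Z : Matrix d d ℂ) * Q * Wᴴ * (V : Matrix d d ℂ) := by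
    calc _ = ((U : Matrix d d ℂ)ᴴ * (U : Matrix d d ℂ)) * A * ((U : Matrix d d ℂ)ᴴ *
          (V : Matrix d d ℂ)) * B * ((V : Matrix d d ℂ)ᴴ * (V : Matrix d d ℂ)) := by
          rw [conjTranspose_mul_unitary, conjTranspose_mul_unitary, one_mul, mul_one]
      _ = (U : Matrix d d ℂ)ᴴ * ((U : Matrix d d ℂ) * A * (U : Matrix d d ℂ)ᴴ *
          ((V : Matrix d d ℂ) * B * (V : Matrix d d ℂ)ᴴ)) * (V : Matrix d d ℂ) := by
          simp only [mul_assoc]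
      _ = _ := by rw [h]; simp only [mul_assoc]
  calc _ = (Da * (A * ((U : Matrix d d ℂ)ᴴ * (V : Matrix d d ℂ)) * B) * Db *
      ((V : Matrix d d ℂ)ᴴ * W') * Dt * (Y * (U : Matrix d d ℂ))).trace := by
        simp only [mul_assoc]
    _ = ((Da * ((U : Matrix d d ℂ)ᴴ * (Z : Matrix d d ℂ))) * (Q * Wᴴ * (V : Matrix d d ℂ) * Db *
      ((V : Matrix d d ℂ)ᴴ * W') * Dt * (Y * (U : Matrix d d ℂ)))).trace := by
        rw [h']; simp only [mul_assoc]
    _ = _ := by rw [trace_mul_comm]; simp only [mul_assoc]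

/-- **Araki–Lieb–Thirring inequality** for exponents in `[1/2, 1]`. -/
theorem araki_lieb_thirring (U V W : unitaryGroup d ℂ) (a b q : d → ℝ) (ha : ∀ i, 0 < a i)
    (hb : ∀ i, 0 < b i) (hq : ∀ i, 0 < q i) {r : ℝ} (hr : 1 / 2 ≤ r) (hr1 : r ≤ 1)
    (h : (spec U (fun i => √(a i)) * spec V (fun i => √(b i)))ᴴ *
      (spec U (fun i => √(a i)) * spec V (fun i => √(b i))) = spec W q) :
    ∑ i, ∑ j, a i ^ r * b j ^ r * overlap U V i j ≤ ∑ i, q i ^ r := by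
  have hr0 : 0 < r := by linarith
  set α : d → ℝ := fun i => a i ^ (r / 2)
  set β : d → ℝ := fun i => b i ^ (r / 2)
  have hα : ∀ i, 0 < α i := fun i => Real.rpow_pos_of_pos (ha i) _
  have hβ : ∀ i, 0 < β i := fun i => Real.rpow_pos_of_pos (hb i) _
  set T := spec U α * spec V β with hT
  have hTinv : spec V (fun i => (β i)⁻¹) * spec U (fun i => (α i)⁻¹) * T = 1 := by
    rw [mul_eq_one_comm, hT, mul_assoc, ← mul_assoc (spec V β), spec_mul_spec_inv V hβ, one_mul,
      spec_mul_spec_inv U hα]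
  obtain ⟨W', p, hp, hTp⟩ := PosDef.exists_spec (conjTranspose_mul_self_posDef hTinv)
  obtain ⟨Z, hZ⟩ := exists_svd _ W q hq h
  obtain ⟨Z', hZ'⟩ := exists_svd T W' p hp hTp
  have hL : ∑ i, p i = ∑ i, ∑ j, a i ^ r * b j ^ r * overlap U V i j := by
    rw [← trace_spec W' p, ← hTp, hT, conjTranspose_mul, (spec_isHermitian U α).eq,
      (spec_isHermitian V β).eq, mul_assoc, trace_mul_comm, ← mul_assoc (spec U α), spec_mul_spec,
      mul_assoc, spec_mul_spec, trace_spec_mul_spec]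
    refine Finset.sum_congr rfl fun i _ => Finset.sum_congr rfl fun j _ => ?_
    rw [← Real.rpow_add (ha i), ← Real.rpow_add (hb j), add_halves]
  rw [← hL]
  -- Here `p` lists the squared singular values of `T = A^(r/2) B^(r/2)`. The exponent `2 - z / r`
  -- equals `1` at `z = r`, where the trace becomes `Tr[T Tᴴ] = ∑ p`; on `Re z = 0` its real part is
  -- `2`, and all factors but `p` have modulus one or are unitary.
  set f : ℂ → ℂ := fun z => (diagonal (fun i => (a i : ℂ) ^ (z / 2)) *
      ((star U * V : unitaryGroup d ℂ) : Matrix d d ℂ) *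
      diagonal (fun i => (b i : ℂ) ^ (z / 2)) * ((star V * W' : unitaryGroup d ℂ) : Matrix d d ℂ) *
      diagonal (fun i => (√(p i) : ℂ) ^ (2 - z / r)) *
        ((star Z' * U : unitaryGroup d ℂ) : Matrix d d ℂ)).trace with hf
  have hsp : ∀ i, 0 < √(p i) := fun i => Real.sqrt_pos.mpr (hp i)
  have hcyc : ∀ D₁ D₂ D₃ : Matrix d d ℂ, (D₁ * ((star U * V : unitaryGroup d ℂ) : Matrix d d ℂ) *
      D₂ * ((star V * W' : unitaryGroup d ℂ) : Matrix d d ℂ) * D₃ *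
        ((star Z' * U : unitaryGroup d ℂ) : Matrix d d ℂ)).trace =
      (((U : Matrix d d ℂ) * D₁ * (U : Matrix d d ℂ)ᴴ) *
        ((V : Matrix d d ℂ) * D₂ * (V : Matrix d d ℂ)ᴴ) * (W' : Matrix d d ℂ) * D₃ *
          (Z' : Matrix d d ℂ)ᴴ).trace := by
    intro D₁ D₂ D₃
    simp only [coe_star_mul]
    rw [← mul_assoc _ (Z' : Matrix d d ℂ)ᴴ, trace_mul_comm]
    simp only [mul_assoc]
  have hfr : f r = ((∑ i, p i : ℝ) : ℂ) := by
    have e1 : (fun i => (a i : ℂ) ^ ((r : ℂ) / 2)) = fun i => ((α i : ℝ) : ℂ) := by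
      ext i; simp only [α]; rw [Complex.ofReal_cpow (ha i).le]; norm_num
    have e2 : (fun i => (b i : ℂ) ^ ((r : ℂ) / 2)) = fun i => ((β i : ℝ) : ℂ) := by
      ext i; simp only [β]; rw [Complex.ofReal_cpow (hb i).le]; norm_num
    have e3 : (2 : ℂ) - (r : ℂ) / r = 1 := by
      rw [div_self (by exact_mod_cast hr0.ne')]; norm_num
    have e4 : (fun i => (√(p i) : ℂ) * √(p i)) = fun i => ((p i : ℝ) : ℂ) := by
      ext i; exact_mod_cast Real.mul_self_sqrt (hp i).le
    simp only [hf, e1, e2, e3, Complex.cpow_one]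
    rw [hcyc]
    change (spec U α * spec V β * _ * _ * _).trace = _
    rw [← hT, hZ']
    calc _ = ((Z' : Matrix d d ℂ) * diagonal (fun i => (√(p i) : ℂ)) *
          ((W' : Matrix d d ℂ)ᴴ * (W' : Matrix d d ℂ)) * diagonal (fun i => (√(p i) : ℂ)) *
            (Z' : Matrix d d ℂ)ᴴ).trace := by simp only [mul_assoc]
      _ = _ := by
        rw [conjTranspose_mul_unitary, mul_one, trace_mul_comm, ← mul_assoc, ← mul_assoc,
          conjTranspose_mul_unitary, one_mul, diagonal_mul_diagonal, e4, trace_diagonal,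
          Complex.ofReal_sum]
  have hunit : ∀ (c : d → ℝ) (_ : ∀ i, 0 < c i) (y : ℝ),
      diagonal (fun i => (c i : ℂ) ^ (y * Complex.I / 2)) ∈ unitaryGroup d ℂ := by
    intro c hc y
    refine diagonal_mem_unitaryGroup _ fun i => ?_
    rw [Complex.norm_cpow_eq_rpow_re_of_pos (hc i)]
    simp
  have h0 : ∀ y : ℝ, ‖f (y * Complex.I)‖ ≤ ∑ i, p i := by
    intro y
    have hle := norm_trace_diagonal_mul_le
      ((star U * V) * ⟨_, hunit b hb y⟩ * (star V * W')) (star Z' * U)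
      (fun i => (a i : ℂ) ^ (y * Complex.I / 2))
      (fun i => (√(p i) : ℂ) ^ (2 - y * Complex.I / r)) 0 p (by
        intro i j
        rw [Complex.norm_cpow_eq_rpow_re_of_pos (ha i), Complex.norm_cpow_eq_rpow_re_of_pos (hsp j)]
        simp [Real.sq_sqrt (hp j).le])
    simp only [Pi.zero_apply, Finset.sum_const_zero, zero_add] at hle
    convert hle using 3
    simp only [Submonoid.coe_mul, mul_assoc]
  have h1 : ∀ y : ℝ, ‖f (1 + y * Complex.I)‖ ≤
      1 / (2 * r) * ∑ i, q i ^ r + (1 - 1 / (2 * r)) * ∑ i, p i := by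
    intro y
    have hle := norm_trace_diagonal_mul_le
      ((star W * V) * ⟨_, hunit b hb y⟩ * (star V * W'))
      ((star Z' * U) * ⟨_, hunit a ha y⟩ * (star U * Z))
      (fun i => (√(q i) : ℂ))
      (fun i => (√(p i) : ℂ) ^ (2 - (1 + y * Complex.I) / r))
      (fun i => 1 / (2 * r) * q i ^ r) (fun j => (1 - 1 / (2 * r)) * p j) (by
        intro i j
        rw [Complex.norm_cpow_eq_rpow_re_of_pos (hsp j), Complex.norm_real, Real.norm_eq_abs,
          abs_of_pos (Real.sqrt_pos.mpr (hq i))]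
        -- Young's inequality with weights `1 / (2r)` and `1 - 1 / (2r)`; the second is nonnegative
        -- exactly because `r ≥ 1/2`.
        have e1 : √(q i) = (q i ^ r) ^ (1 / (2 * r)) := by
          rw [← Real.rpow_mul (hq i).le, Real.sqrt_eq_rpow]
          congr 1; field_simp
        have e2 : √(p j) ^ ((2 - (1 + y * Complex.I) / r : ℂ).re) = p j ^ (1 - 1 / (2 * r)) := by
          rw [Real.sqrt_eq_rpow, ← Real.rpow_mul (hp j).le]
          congr 1
          simp
          field_simp
        rw [e1, e2]
        refine Real.geom_mean_le_arith_mean2_weighted (by positivity) ?_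
          (Real.rpow_pos_of_pos (hq i) _).le (hp j).le (by ring)
        rw [sub_nonneg, div_le_one (by positivity)]; linarith)
    rw [← Finset.mul_sum, ← Finset.mul_sum] at hle
    refine le_trans (le_of_eq ?_) hle
    -- On `Re z = 1` each power splits into a square root, absorbed in the singular value
    -- decomposition, and a phase, absorbed in the unitaries.
    have es : ∀ (c : d → ℝ) (_ : ∀ i, 0 < c i),
        (fun i => (c i : ℂ) ^ ((1 + y * Complex.I) / 2)) =
          fun i => (c i : ℂ) ^ (y * Complex.I / 2) * (√(c i) : ℂ) := by
      intro c hc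
      ext i
      have hc0 : (c i : ℂ) ≠ 0 := by exact_mod_cast (hc i).ne'
      rw [Real.sqrt_eq_rpow, Complex.ofReal_cpow (hc i).le, ← Complex.cpow_add _ _ hc0]
      congr 1
      push_cast
      ring
    have es' : ∀ (c : d → ℝ) (_ : ∀ i, 0 < c i),
        diagonal (fun i => (c i : ℂ) ^ ((1 + y * Complex.I) / 2)) =
          diagonal (fun i => (c i : ℂ) ^ (y * Complex.I / 2)) *
            diagonal (fun i => (√(c i) : ℂ)) := by
      intro c hc
      rw [diagonal_mul_diagonal, es c hc]
    have es'' : ∀ (c : d → ℝ) (_ : ∀ i, 0 < c i),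
        diagonal (fun i => (c i : ℂ) ^ ((1 + y * Complex.I) / 2)) =
            diagonal (fun i => (√(c i) : ℂ)) *
          diagonal (fun i => (c i : ℂ) ^ (y * Complex.I / 2)) := by
      intro c hc
      rw [es' c hc, diagonal_mul_diagonal, diagonal_mul_diagonal]
      simp only [mul_comm]
    refine congrArg norm ?_
    simp only [hf]
    rw [es' a ha, es'' b hb]
    simp only [Submonoid.coe_mul, coe_star_eq]
    simp only [spec] at hZ
    exact trace_cycle_of_eq U V Z _ _ _ (W : Matrix d d ℂ) _ _ _ _ _ hZ
  have key := norm_trace_interpolation _ _ _ a b (fun i => √(p i)) ha hb hsp hr0 hr1 f hf h0 h1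
  rw [hfr, Complex.norm_real, Real.norm_eq_abs,
    abs_of_nonneg (Finset.sum_nonneg fun i _ => (hp i).le)] at key
  have hK : 0 ≤ ∑ i, q i ^ r := Finset.sum_nonneg fun i _ => (Real.rpow_pos_of_pos (hq i) _).le
  have hL0 : 0 ≤ ∑ i, p i := Finset.sum_nonneg fun i _ => (hp i).le
  -- With `L = ∑ p`, `K = ∑ q^r` and `θ = 1 / (2r)`, interpolation reads `L ≤ L^(1-r) (θ K + (1 - θ)
  -- L)^r`. For `L > 0` one cancels `L^(1-r)`, takes the `r`-th root and absorbs `(1 - θ) L`,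
  -- leaving `L ≤ K`.
  rcases hL0.eq_or_lt with hL0 | hL0
  · rw [← hL0]; exact hK
  set L := ∑ i, p i
  set K := ∑ i, q i ^ r
  have hθ : 0 < 1 / (2 * r) := by positivity
  have hθ1 : 1 / (2 * r) ≤ 1 := by rw [div_le_one (by positivity)]; linarith
  set θ := 1 / (2 * r)
  have hB : 0 ≤ θ * K + (1 - θ) * L := by
    have : 0 ≤ 1 - θ := by linarith
    positivity
  have h2 : L ^ r ≤ (θ * K + (1 - θ) * L) ^ r := by
    have e : L = L ^ (1 - r) * L ^ r := by
      rw [← Real.rpow_add hL0]; simp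
    have : L ^ (1 - r) * L ^ r ≤ L ^ (1 - r) * (θ * K + (1 - θ) * L) ^ r := by rwa [← e]
    exact le_of_mul_le_mul_left this (Real.rpow_pos_of_pos hL0 _)
  have h3 := (Real.rpow_le_rpow_iff hL0.le hB hr0).mp h2
  have : θ * L ≤ θ * K := by linarith
  exact le_of_mul_le_mul_left this hθ

end ArakiLiebThirring

end QDiv

namespace QDiv

open Matrix MeasureTheory Set Filter

/-! ### Scalar integrals of step functions and powers -/

section ScalarIntegrals

lemma integrableOn_step (c : ℝ) :
    IntegrableOn (fun u : ℝ => if u < c then (1 : ℝ) else 0) (Ioi 0) ∧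
      ∫ u in Ioi (0 : ℝ), (if u < c then (1 : ℝ) else 0) = max c 0 := by
  have h : (fun u : ℝ => if u < c then (1 : ℝ) else 0) = (Iio c).indicator fun _ => 1 := by
    ext u; simp [indicator_apply]
  rw [h]
  constructor
  · rw [IntegrableOn, integrable_indicator_iff measurableSet_Iio, IntegrableOn,
      Measure.restrict_restrict measurableSet_Iio, Set.inter_comm, Ioi_inter_Iio]
    exact integrableOn_const (by simp)
  · rw [setIntegral_indicator measurableSet_Iio, Ioi_inter_Iio]
    simp

lemma integrableOn_rpow_step {s c : ℝ} (hs : s < -1) (hc : 0 < c) :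
    IntegrableOn (fun t : ℝ => t ^ s * if c < t then (1 : ℝ) else 0) (Ioi 0) ∧
      ∫ t in Ioi (0 : ℝ), (t ^ s * if c < t then (1 : ℝ) else 0) = c ^ (s + 1) / (-(s + 1)) := by
  have h : (fun t : ℝ => t ^ s * if c < t then (1 : ℝ) else 0) =
      (Ioi c).indicator fun t => t ^ s := by
    ext u; simp [indicator_apply]
  have hI : Ioi c ∩ Ioi (0 : ℝ) = Ioi c := by
    rw [Ioi_inter_Ioi]; congr 1; exact max_eq_left hc.le
  rw [h]
  constructor
  · rw [IntegrableOn, integrable_indicator_iff measurableSet_Ioi, IntegrableOn,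
      Measure.restrict_restrict measurableSet_Ioi, hI]
    exact integrableOn_Ioi_rpow_of_lt hs hc
  · rw [setIntegral_indicator measurableSet_Ioi, Set.inter_comm, hI, integral_Ioi_rpow_of_lt hs hc]
    rw [neg_div, div_neg]

/-- Bernoulli's inequality gives `0 ≤ (a + u)^α - u^α ≤ α a u^(α-1)`, which vanishes at infinity
because `α < 1`. -/
lemma tendsto_rpow_sub_rpow_add {α a : ℝ} (hα : 0 < α) (hα1 : α < 1) (ha : 0 ≤ a) :
    Tendsto (fun u : ℝ => (u ^ α - (a + u) ^ α) / α) atTop (𝓝 0) := by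
  have h : Tendsto (fun u : ℝ => (u ^ α - (a + u) ^ α)) atTop (𝓝 0) := by
    have h1 : Tendsto (fun u : ℝ => -(α * a * u ^ (-(1 - α)))) atTop (𝓝 0) := by
      have := (tendsto_rpow_neg_atTop (y := 1 - α) (by linarith)).const_mul (α * a)
      simpa using this.neg
    refine tendsto_of_tendsto_of_tendsto_of_le_of_le' h1 tendsto_const_nhds ?_ ?_
    · filter_upwards [eventually_gt_atTop 0] with u hu
      have h2 : (a + u) ^ α = u ^ α * (1 + a / u) ^ α := by
        rw [← Real.mul_rpow hu.le (by positivity)]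
        congr 1; field_simp; ring
      have hau : 0 ≤ a / u := by positivity
      have h3 : (1 + a / u) ^ α ≤ 1 + α * (a / u) :=
        rpow_one_add_le_one_add_mul_self (by linarith) hα.le hα1.le
      have h4 : u ^ (-(1 - α)) = u ^ α / u := by
        rw [show -(1 - α) = α - 1 by ring, Real.rpow_sub hu, Real.rpow_one]
      have h5 : u ^ α * (1 + a / u) ^ α ≤ u ^ α * (1 + α * (a / u)) :=
        mul_le_mul_of_nonneg_left h3 (by positivity)
      rw [h2, h4]
      have : u ^ α * (1 + α * (a / u)) = u ^ α + α * a * (u ^ α / u) := by field_simp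
      linarith
    · filter_upwards [eventually_gt_atTop 0] with u hu
      have := Real.rpow_le_rpow hu.le (by linarith : u ≤ a + u) hα.le
      linarith
  simpa using h.div_const α

lemma integral_rpow_sub_rpow_add {α a : ℝ} (hα : 0 < α) (hα1 : α < 1) (ha : 0 ≤ a) :
    IntegrableOn (fun u : ℝ => u ^ (α - 1) - (a + u) ^ (α - 1)) (Ioi 0) ∧
      ∫ u in Ioi (0 : ℝ), (u ^ (α - 1) - (a + u) ^ (α - 1)) = a ^ α / α := by
  have hcont : ContinuousWithinAt (fun u : ℝ => (u ^ α - (a + u) ^ α) / α) (Ici 0) 0 := by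
    apply Continuous.continuousWithinAt
    have h1 : Continuous fun u : ℝ => u ^ α :=
      Continuous.rpow_const continuous_id fun _ => Or.inr hα.le
    have h2 : Continuous fun u : ℝ => (a + u) ^ α :=
      Continuous.rpow_const (by fun_prop) fun _ => Or.inr hα.le
    fun_prop
  have hderiv : ∀ u ∈ Ioi (0 : ℝ), HasDerivAt (fun u : ℝ => (u ^ α - (a + u) ^ α) / α)
      (u ^ (α - 1) - (a + u) ^ (α - 1)) u := by
    intro u hu
    have hu : 0 < u := hu
    have h1 := Real.hasDerivAt_rpow_const (x := u) (p := α) (Or.inl hu.ne')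
    have h2 := ((hasDerivAt_id u).const_add a).rpow_const (p := α)
      (Or.inl (by simp only [id]; positivity))
    refine ((h1.sub h2).div_const α).congr_deriv ?_
    simp only [id]
    field_simp
  have hpos : ∀ u ∈ Ioi (0 : ℝ), 0 ≤ u ^ (α - 1) - (a + u) ^ (α - 1) := by
    intro u hu
    have hu : 0 < u := hu
    have := Real.rpow_le_rpow_of_nonpos hu (by linarith : u ≤ a + u) (by linarith : α - 1 ≤ 0)
    linarith
  have hlim := tendsto_rpow_sub_rpow_add hα hα1 ha
  refine ⟨integrableOn_Ioi_deriv_of_nonneg hcont hderiv hpos hlim, ?_⟩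
  rw [integral_Ioi_of_hasDerivAt_of_nonneg hcont hderiv hpos hlim, Real.zero_rpow hα.ne']
  simp; ring

/-- Eigenvalue counts become pointwise limits of difference quotients of traces of positive parts,
which is how their measurability is obtained. -/
lemma tendsto_difference_quotient (l u : ℝ) :
    Tendsto (fun n : ℕ => ((n : ℝ) + 1) * (max (l - u) 0 - max (l - (u + 1 / ((n : ℝ) + 1))) 0))
      atTop (𝓝 (if u < l then 1 else 0)) := by
  split_ifs with h
  · have h1 : ∀ᶠ n : ℕ in atTop, 1 / ((n : ℝ) + 1) < l - u :=
      (tendsto_one_div_add_atTop_nhds_zero_nat).eventually (gt_mem_nhds (by linarith))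
    refine tendsto_const_nhds.congr' ?_
    filter_upwards [h1] with n hn
    rw [max_eq_left (by linarith), max_eq_left (by linarith)]
    field_simp
    ring
  · refine tendsto_const_nhds.congr fun n => ?_
    have : (0 : ℝ) < 1 / ((n : ℝ) + 1) := by positivity
    rw [max_eq_right (by linarith), max_eq_right (by linarith)]
    simp

end ScalarIntegrals

/-! ### Counting eigenvalues, and the integral inequality for invertible `σ` -/

section SpectralShift

lemma dotProduct_conj_mulVec {d : Type*} [Fintype d] {S B : Matrix d d ℂ} (hS : S.IsHermitian) (v : d → ℂ) :
    star v ⬝ᵥ ((S * B * S) *ᵥ v) = star (S *ᵥ v) ⬝ᵥ (B *ᵥ (S *ᵥ v)) := by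
  rw [star_mulVec, hS.eq, ← dotProduct_mulVec, mulVec_mulVec, mulVec_mulVec, mul_assoc]

variable {d : Type*} [Fintype d] [DecidableEq d]

/-- Sylvester's law of inertia for congruence by an invertible Hermitian matrix. -/
lemma card_pos_eq_of_congruence (U V : unitaryGroup d ℂ) (x y : d → ℝ) {S R : Matrix d d ℂ}
    (hS : S.IsHermitian) (hR : R.IsHermitian) (hSR : S * R = 1)
    (h : spec U x = S * spec V y * S) :
    (Finset.univ.filter fun i => 0 < x i).card = (Finset.univ.filter fun j => 0 < y j).card := by
  apply le_antisymm
  · exact card_pos_le_card_pos U V x y S fun v => by rw [h, dotProduct_conj_mulVec hS]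
  · have hRS : R * S = 1 := mul_eq_one_comm.mp hSR
    have h' : spec V y = R * spec U x * R := by
      rw [h]
      calc spec V y = (R * S) * spec V y * (S * R) := by rw [hRS, hSR, one_mul, mul_one]
        _ = _ := by simp only [mul_assoc]
    exact card_pos_le_card_pos V U y x R fun v => by rw [h', dotProduct_conj_mulVec hR]

/-- The eigenvalues `x` of `σ^{-1/2} (ρ + u) σ^{-1/2}` count the eigenvalues of `t σ - ρ` above
`u`, and the trace of their negative powers is controlled by the Araki–Lieb–Thirring
inequality. -/
lemma exists_relative_eigenvalues (U V : unitaryGroup d ℂ) (a b : d → ℝ) (ha : ∀ i, 0 ≤ a i)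
    (hb : ∀ i, 0 < b i) {u : ℝ} (hu : 0 < u) :
    ∃ x : d → ℝ, (∀ i, 0 < x i) ∧
      (∀ (t : ℝ) (W : unitaryGroup d ℂ) (l : d → ℝ), (t : ℂ) • spec V b - spec U a = spec W l →
        (Finset.univ.filter fun i => u < l i).card =
          (Finset.univ.filter fun i => x i < t).card) ∧
      ∀ r : ℝ, 1 / 2 ≤ r → r ≤ 1 →
        ∑ i, ∑ j, (a i + u) ^ (-r) * b j ^ r * overlap U V i j ≤ ∑ i, x i ^ (-r) := by
  have hau : ∀ i, 0 < a i + u := fun i => by have := ha i; linarith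
  have hau' : ∀ i, 0 < (a i + u)⁻¹ := fun i => inv_pos.mpr (hau i)
  have hs : ∀ i, 0 < √(b i) := fun i => Real.sqrt_pos.mpr (hb i)
  have hsa : ∀ i, 0 < √(a i + u) := fun i => Real.sqrt_pos.mpr (hau i)
  set s := spec V (fun i => √(b i))
  set s' := spec V (fun i => (√(b i))⁻¹)
  set m := spec U (fun i => √(a i + u))
  set m' := spec U (fun i => (√(a i + u))⁻¹)
  have hss' : s * s' = 1 := spec_mul_spec_inv V hs
  have hs's : s' * s = 1 := mul_eq_one_comm.mp hss'
  have hmm' : m * m' = 1 := spec_mul_spec_inv U hsa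
  have hm'm : m' * m = 1 := mul_eq_one_comm.mp hmm'
  have hsH : s.IsHermitian := spec_isHermitian _ _
  have hs'H : s'.IsHermitian := spec_isHermitian _ _
  have hmH : m.IsHermitian := spec_isHermitian _ _
  have hm'H : m'.IsHermitian := spec_isHermitian _ _
  have hssb : s * s = spec V b := by
    rw [spec_mul_spec]; congr 1; ext i; exact Real.mul_self_sqrt (hb i).le
  have hmma : m * m = spec U (fun i => a i + u) := by
    rw [spec_mul_spec]; congr 1; ext i; exact Real.mul_self_sqrt (hau i).le
  have hinv : (s * m') * (m * s') = 1 := by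
    rw [mul_assoc, ← mul_assoc m', hm'm, one_mul, hss']
  have hX : (m * s')ᴴ * (m * s') = s' * spec U (fun i => a i + u) * s' := by
    rw [conjTranspose_mul, hmH.eq, hs'H.eq, ← hmma]; simp only [mul_assoc]
  obtain ⟨W, x, hx, hWx⟩ := PosDef.exists_spec (conjTranspose_mul_self_posDef hinv)
  refine ⟨x, hx, ?_, ?_⟩
  · intro t W' l hl
    -- The congruence `tσ - ρ - u = σ^(1/2) (t - X_u) σ^(1/2)`, to which the law of inertia applies.
    have h1 : spec W' (fun i => l i - u) = s * spec W (fun i => t - x i) * s := by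
      rw [← spec_sub, ← spec_sub, spec_const, spec_const, ← hl, ← hWx, hX, mul_sub, sub_mul,
        mul_smul_comm, smul_mul_assoc, mul_one, hssb]
      have : s * (s' * spec U (fun i => a i + u) * s') * s = spec U (fun i => a i + u) := by
        calc _ = (s * s') * spec U (fun i => a i + u) * (s' * s) := by simp only [mul_assoc]
          _ = _ := by rw [hss', hs's, one_mul, mul_one]
      rw [this, ← spec_add, spec_const]
      abel
    have h2 := card_pos_eq_of_congruence _ _ _ _ hsH hs'H hss' h1
    simpa only [sub_pos] using h2
  · intro r hr hr1
    have e1 : (fun i => √((a i + u)⁻¹)) = fun i => (√(a i + u))⁻¹ := by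
      ext i; rw [Real.sqrt_inv]
    have h2 : (m' * s)ᴴ * (m' * s) = spec W (fun i => (x i)⁻¹) := by
      have e2 : spec W x * ((m' * s)ᴴ * (m' * s)) = 1 := by
        rw [← hWx, conjTranspose_mul, conjTranspose_mul, hmH.eq, hs'H.eq, hm'H.eq, hsH.eq]
        calc s' * m * (m * s') * (s * m' * (m' * s))
            = s' * m * (m * (s' * s) * m') * m' * s := by simp only [mul_assoc]
          _ = s' * m * m' * s := by rw [hs's, mul_one m, hmm', mul_one]
          _ = 1 := by rw [mul_assoc s', hmm', mul_one, hs's]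
      exact (left_inv_eq_right_inv (mul_eq_one_comm.mp e2)
        (spec_mul_spec_inv W hx))
    have h3 := araki_lieb_thirring U V W (fun i => (a i + u)⁻¹) b (fun i => (x i)⁻¹) hau' hb
      (fun i => inv_pos.mpr (hx i)) hr hr1 (by rw [e1]; exact h2)
    simpa only [Real.rpow_neg (hx _).le, Real.rpow_neg (hau _).le, Real.inv_rpow (hx _).le,
      Real.inv_rpow (hau _).le] using h3

/-- Joint measurability of the eigenvalue counting function of a monotone family. -/
lemma measurable_eigenvalue_count {A : ℝ → Matrix d d ℂ}
    (hmono : ∀ t t' : ℝ, t ≤ t' → (A t' - A t).PosSemidef)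
    (W : ℝ → unitaryGroup d ℂ) (l : ℝ → d → ℝ) (hl : ∀ t, A t = spec (W t) (l t)) :
    Measurable fun p : ℝ × ℝ => ∑ i, if p.2 < l p.1 i then (1 : ℝ) else 0 := by
  -- `Tr (A_t - u)₊` is continuous in `u` and monotone in `t`, hence jointly measurable even though
  -- the eigenvalues were chosen arbitrarily for each `t`.
  set g : ℝ → ℝ → ℝ := fun u t => ∑ i, max (l t i - u) 0
  have hg : Measurable (Function.uncurry g) := by
    apply measurable_uncurry_of_continuous_of_measurable
    · intro t
      simp only [g]
      fun_prop
    · intro u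
      apply Monotone.measurable
      intro t t' htt'
      have e : ∀ t, spec (W t) (fun i => l t i - u) = A t - (u : ℂ) • 1 := fun t => by
        rw [hl, ← spec_const (W t), spec_sub]
      have h := trPosPart_mono (spec_isHermitian (W t) (fun i => l t i - u))
        (B := spec (W t') (fun i => l t' i - u)) (by
          rw [e, e]
          have := hmono t t' htt'
          simpa using this)
      rwa [trPosPart_spec, trPosPart_spec] at h
  refine measurable_of_tendsto_metrizable (f := fun (n : ℕ) (p : ℝ × ℝ) =>
    ((n : ℝ) + 1) * (g p.2 p.1 - g (p.2 + 1 / ((n : ℝ) + 1)) p.1)) (fun n => ?_) ?_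
  · have h1 : Measurable fun p : ℝ × ℝ => g p.2 p.1 :=
      hg.comp (measurable_snd.prodMk measurable_fst)
    have h2 : Measurable fun p : ℝ × ℝ => g (p.2 + 1 / ((n : ℝ) + 1)) p.1 :=
      hg.comp ((measurable_snd.add_const _).prodMk measurable_fst)
    exact (h1.sub h2).const_mul _
  · rw [tendsto_pi_nhds]
    intro p
    simp only [g, ← Finset.sum_sub_distrib, Finset.mul_sum]
    exact tendsto_finsetSum _ fun i _ => tendsto_difference_quotient _ _

/-- The layer-cake formula in `u`, Tonelli, and Araki–Lieb–Thirring for each fixed `u`. Lower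
integrals avoid having to know beforehand that the left side is finite. -/
theorem lintegral_trace_min_le_of_pos (U V : unitaryGroup d ℂ) (a b : d → ℝ)
    (ha : ∀ i, 0 ≤ a i) (hb : ∀ i, 0 < b i) {α : ℝ} (hα : 0 < α) (hα1 : α ≤ 1 / 2) :
    ∫⁻ t in Ioi (0 : ℝ), ENNReal.ofReal (t ^ (α - 2) *
        (∑ i, a i - trPosPart (spec U a - (t : ℂ) • spec V b))) ≤
      ENNReal.ofReal (1 / (α * (1 - α)) *
        ∑ i, ∑ j, a i ^ α * b j ^ (1 - α) * overlap U V i j) := by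
  set A : ℝ → Matrix d d ℂ := fun t => (t : ℂ) • spec V b - spec U a
  have hA : ∀ t, (A t).IsHermitian := fun t => by
    simp only [A]; rw [spec_smul]; exact (spec_isHermitian _ _).sub (spec_isHermitian _ _)
  choose W l hl using fun t => IsHermitian.exists_spec (hA t)
  choose! x hx hcount hALT using fun (u : ℝ) (hu : u ∈ Ioi (0 : ℝ)) =>
    exists_relative_eigenvalues U V a b ha hb hu
  set N : ℝ → ℝ → ℝ := fun t u => ∑ i, if u < l t i then 1 else 0
  set N₀ : ℝ → ℝ → ℝ := fun t u => ∑ j, if u < t * b j then 1 else 0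
  have hM : ∀ t : ℝ, ∑ i, a i - trPosPart (spec U a - (t : ℂ) • spec V b) =
      ∑ j, max (t * b j) 0 - ∑ i, max (l t i) 0 + (∑ j, t * b j - ∑ j, max (t * b j) 0) := by
    intro t
    have h1 : spec U a - (t : ℂ) • spec V b = -A t := by simp [A]
    have h2 : (A t).trace.re = ∑ j, t * b j - ∑ i, a i := by
      simp only [A]
      rw [trace_sub, Complex.sub_re, spec_smul, trace_spec, trace_spec]
    rw [h1, trPosPart_neg (hA t), h2, hl t, trPosPart_spec]
    ring
  have hM' : ∀ t ∈ Ioi (0 : ℝ), ∑ i, a i - trPosPart (spec U a - (t : ℂ) • spec V b) =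
      ∑ j, max (t * b j) 0 - ∑ i, max (l t i) 0 := by
    intro t ht
    rw [hM]
    have : ∀ j, max (t * b j) 0 = t * b j := fun j =>
      max_eq_left (mul_nonneg (le_of_lt ht) (hb j).le)
    simp only [this, sub_self, add_zero]
  -- Because `tσ - ρ ≤ tσ`. This makes the integrand nonnegative, as Tonelli requires.
  have hNle : ∀ t u, N t u ≤ N₀ t u := by
    intro t u
    have h := card_pos_le_card_pos (W t) V (fun i => l t i - u) (fun j => t * b j - u) 1 (by
      intro v
      rw [one_mulVec, ← spec_sub, ← spec_sub, ← hl, spec_const, spec_const, ← spec_smul]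
      simp only [A, sub_mulVec, dotProduct_sub, Complex.sub_re]
      have := (spec_posSemidef U ha).re_dotProduct_nonneg v
      simp only [RCLike.re_to_complex] at this
      linarith)
    simp only [sub_pos] at h
    simp only [N, N₀, Finset.sum_boole]
    exact_mod_cast h
  have hint : ∀ t, IntegrableOn (fun u => N₀ t u - N t u) (Ioi 0) ∧
      ∫ u in Ioi (0 : ℝ), (N₀ t u - N t u) = ∑ j, max (t * b j) 0 - ∑ i, max (l t i) 0 := by
    intro t
    have h1 : IntegrableOn (fun u => N₀ t u) (Ioi 0) :=
      integrable_finsetSum _ fun j _ => (integrableOn_step _).1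
    have h2 : IntegrableOn (fun u => N t u) (Ioi 0) :=
      integrable_finsetSum _ fun j _ => (integrableOn_step _).1
    refine ⟨h1.sub h2, ?_⟩
    rw [integral_sub h1 h2]
    simp only [N, N₀]
    rw [integral_finsetSum _ fun j _ => (integrableOn_step _).1,
      integral_finsetSum _ fun j _ => (integrableOn_step _).1]
    simp only [(integrableOn_step _).2]
  have hmeasN : Measurable fun p : ℝ × ℝ => N p.1 p.2 := by
    refine measurable_eigenvalue_count (fun t t' htt' => ?_) W l hl
    have : A t' - A t = spec V (fun i => (t' - t) * b i) := by
      simp only [A]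
      rw [← spec_smul]
      push_cast
      rw [sub_smul]
      abel
    rw [this]
    exact spec_posSemidef _ fun i => mul_nonneg (sub_nonneg.mpr htt') (hb i).le
  have hmeasN₀ : Measurable fun p : ℝ × ℝ => N₀ p.1 p.2 := by
    refine Finset.measurable_fun_sum _ fun j _ => Measurable.ite ?_ measurable_const measurable_const
    exact measurableSet_lt measurable_snd (measurable_fst.mul_const _)
  have hin : ∀ u ∈ Ioi (0 : ℝ), ∫⁻ t in Ioi (0 : ℝ),
      ENNReal.ofReal (t ^ (α - 2) * (N₀ t u - N t u)) ≤
      ENNReal.ofReal (1 / (1 - α) * ∑ i, ∑ j, overlap U V i j * b j ^ (1 - α) *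
        (u ^ (α - 1) - (a i + u) ^ (α - 1))) := by
    intro u hu
    have hu0 : 0 < u := hu
    have e1 : ∀ t ∈ Ioi (0 : ℝ), t ^ (α - 2) * (N₀ t u - N t u) =
        ∑ j, (t ^ (α - 2) * if u / b j < t then 1 else 0) -
          ∑ i, (t ^ (α - 2) * if x u i < t then 1 else 0) := by
      intro t ht
      have h1 : N t u = ∑ i, if x u i < t then 1 else 0 := by
        simp only [N, Finset.sum_boole]
        rw [hcount u hu t (W t) (l t) (hl t)]
      have h2 : N₀ t u = ∑ j, if u / b j < t then 1 else 0 := by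
        simp only [N₀, div_lt_iff₀ (hb _)]
      rw [h1, h2, mul_sub, Finset.mul_sum, Finset.mul_sum]
    have hs : α - 2 < -1 := by linarith
    have i1 : IntegrableOn (fun t : ℝ => ∑ j, (t ^ (α - 2) * if u / b j < t then (1 : ℝ) else 0))
        (Ioi 0) :=
      integrable_finsetSum _ fun j _ => (integrableOn_rpow_step hs (div_pos hu0 (hb j))).1
    have i2 : IntegrableOn (fun t : ℝ => ∑ i, (t ^ (α - 2) * if x u i < t then (1 : ℝ) else 0))
        (Ioi 0) :=
      integrable_finsetSum _ fun i _ => (integrableOn_rpow_step hs (hx u hu i)).1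
    have hval : ∫ t in Ioi (0 : ℝ), t ^ (α - 2) * (N₀ t u - N t u) =
        1 / (1 - α) * (∑ j, (u / b j) ^ (α - 1) - ∑ i, x u i ^ (α - 1)) := by
      rw [setIntegral_congr_fun measurableSet_Ioi e1, integral_sub i1 i2,
        integral_finsetSum _ fun j _ => (integrableOn_rpow_step hs (div_pos hu0 (hb j))).1,
        integral_finsetSum _ fun i _ => (integrableOn_rpow_step hs (hx u hu i)).1]
      simp only [(integrableOn_rpow_step hs (div_pos hu0 (hb _))).2,
        (integrableOn_rpow_step hs (hx u hu _)).2]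
      rw [← Finset.sum_div, ← Finset.sum_div, ← sub_div, show α - 2 + 1 = α - 1 by ring,
        show -(α - 1) = 1 - α by ring]
      ring
    rw [← ofReal_integral_eq_lintegral_ofReal
      ((integrableOn_congr_fun e1 measurableSet_Ioi).mpr (i1.sub i2))
      ((ae_restrict_iff' measurableSet_Ioi).mpr (ae_of_all _ fun t ht =>
        mul_nonneg (Real.rpow_nonneg (le_of_lt ht) _) (sub_nonneg.mpr (hNle t u)))), hval]
    apply ENNReal.ofReal_le_ofReal
    apply mul_le_mul_of_nonneg_left _ (by rw [one_div_nonneg]; linarith)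
    have h1 : ∑ j, (u / b j) ^ (α - 1) =
        ∑ i, ∑ j, overlap U V i j * b j ^ (1 - α) * u ^ (α - 1) := by
      rw [Finset.sum_comm]
      refine Finset.sum_congr rfl fun j _ => ?_
      rw [← Finset.sum_mul, ← Finset.sum_mul, sum_overlap_col, one_mul,
        Real.div_rpow hu0.le (hb j).le, show 1 - α = -(α - 1) by ring, Real.rpow_neg (hb j).le]
      field_simp
    -- The exponent `1 - α` lies in `[1/2, 1]`: this is where `α ≤ 1/2` enters.
    have h2 := hALT u hu (1 - α) (by linarith) (by linarith)
    rw [show -(1 - α) = α - 1 by ring] at h2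
    rw [h1]
    calc _ ≤ ∑ i, ∑ j, overlap U V i j * b j ^ (1 - α) * u ^ (α - 1) -
          ∑ i, ∑ j, (a i + u) ^ (α - 1) * b j ^ (1 - α) * overlap U V i j := by linarith
      _ = _ := by
        rw [← Finset.sum_sub_distrib]
        refine Finset.sum_congr rfl fun i _ => ?_
        rw [← Finset.sum_sub_distrib]
        refine Finset.sum_congr rfl fun j _ => ?_
        ring
  have hα' : α < 1 := by linarith
  calc ∫⁻ t in Ioi (0 : ℝ), ENNReal.ofReal (t ^ (α - 2) *
        (∑ i, a i - trPosPart (spec U a - (t : ℂ) • spec V b)))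
      = ∫⁻ t in Ioi (0 : ℝ), ∫⁻ u in Ioi (0 : ℝ),
          ENNReal.ofReal (t ^ (α - 2) * (N₀ t u - N t u)) := by
        refine setLIntegral_congr_fun measurableSet_Ioi fun t ht => ?_
        rw [hM' t ht, ← (hint t).2, ← integral_const_mul]
        exact ofReal_integral_eq_lintegral_ofReal ((hint t).1.const_mul _)
          (ae_of_all _ fun u => mul_nonneg (Real.rpow_nonneg (le_of_lt ht) _)
            (sub_nonneg.mpr (hNle t u)))
    _ = ∫⁻ u in Ioi (0 : ℝ), ∫⁻ t in Ioi (0 : ℝ),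
          ENNReal.ofReal (t ^ (α - 2) * (N₀ t u - N t u)) := by
        refine lintegral_lintegral_swap (Measurable.aemeasurable ?_)
        refine ENNReal.measurable_ofReal.comp ?_
        exact (measurable_fst.pow_const _).mul (hmeasN₀.sub hmeasN)
    _ ≤ ∫⁻ u in Ioi (0 : ℝ), ENNReal.ofReal (1 / (1 - α) * ∑ i, ∑ j,
          overlap U V i j * b j ^ (1 - α) * (u ^ (α - 1) - (a i + u) ^ (α - 1))) :=
        setLIntegral_mono' measurableSet_Ioi hin
    _ = _ := by
        have hI : ∀ i j, IntegrableOn (fun u : ℝ => overlap U V i j * b j ^ (1 - α) *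
            (u ^ (α - 1) - (a i + u) ^ (α - 1))) (Ioi 0) := fun i j =>
          (integral_rpow_sub_rpow_add hα hα' (ha i)).1.const_mul _
        have hI' : ∀ i, IntegrableOn (fun u : ℝ => ∑ j, overlap U V i j * b j ^ (1 - α) *
            (u ^ (α - 1) - (a i + u) ^ (α - 1))) (Ioi 0) := fun i =>
          integrable_finsetSum _ fun j _ => hI i j
        rw [← ofReal_integral_eq_lintegral_ofReal]
        · congr 1
          rw [integral_const_mul, integral_finsetSum _ fun i _ => hI' i]
          have : ∀ i, ∫ u in Ioi (0 : ℝ), ∑ j, overlap U V i j * b j ^ (1 - α) *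
              (u ^ (α - 1) - (a i + u) ^ (α - 1)) =
              ∑ j, overlap U V i j * b j ^ (1 - α) * (a i ^ α / α) := by
            intro i
            rw [integral_finsetSum _ fun j _ => hI i j]
            refine Finset.sum_congr rfl fun j _ => ?_
            rw [integral_const_mul, (integral_rpow_sub_rpow_add hα hα' (ha i)).2]
          simp only [this, Finset.mul_sum]
          refine Finset.sum_congr rfl fun i _ => Finset.sum_congr rfl fun j _ => ?_
          have : 1 - α ≠ 0 := by linarith
          field_simp
        · exact (integrable_finsetSum _ fun i _ => hI' i).const_mul _
        · refine (ae_restrict_iff' measurableSet_Ioi).mpr (ae_of_all _ fun u hu => ?_)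
          have hu0 : (0 : ℝ) < u := hu
          refine mul_nonneg (by rw [one_div_nonneg]; linarith)
            (Finset.sum_nonneg fun i _ => Finset.sum_nonneg fun j _ => ?_)
          refine mul_nonneg (mul_nonneg (overlap_nonneg _ _ _ _)
            (Real.rpow_nonneg (hb j).le _)) (sub_nonneg.mpr ?_)
          exact Real.rpow_le_rpow_of_nonpos hu0 (by have := ha i; linarith) (by linarith)

end SpectralShift

end QDiv

namespace QDiv

open Matrix MeasureTheory Set Filter

/-! ### Properties of the hockey-stick divergence -/

section HockeyStick

lemma sub_smul_isHermitian {d : Type*} {ρ σ : Matrix d d ℂ} (hρ : ρ.IsHermitian) (hσ : σ.IsHermitian)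
    (γ : ℝ) : (ρ - (γ : ℂ) • σ).IsHermitian := by
  refine hρ.sub ?_
  rw [IsHermitian, conjTranspose_smul, hσ.eq]
  simp

lemma ofReal_smul_posSemidef {d : Type*} {σ : Matrix d d ℂ} (hσ : σ.PosSemidef) {c : ℝ} (hc : 0 ≤ c) :
    ((c : ℂ) • σ).PosSemidef := hσ.smul (by exact_mod_cast hc)

lemma IsState.trace_re {d : Type*} [Fintype d] {ρ : Matrix d d ℂ} (hρ : IsState ρ) : ρ.trace.re = 1 := by
  rw [hρ.trace_eq_one]; rfl

variable {d : Type*} [Fintype d] [DecidableEq d]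

lemma trPosPart_of_posSemidef {ρ : Matrix d d ℂ} (hρ : ρ.PosSemidef) :
    trPosPart ρ = ρ.trace.re := by
  obtain ⟨U, a, ha, rfl⟩ := PosSemidef.exists_spec hρ
  rw [trPosPart_spec, trace_spec]
  exact Finset.sum_congr rfl fun i _ => max_eq_left (ha i)

lemma hockeyStick_antitone {ρ σ : Matrix d d ℂ} (hρ : ρ.IsHermitian) (hσ : σ.PosSemidef) :
    Antitone fun γ : ℝ => hockeyStick γ ρ σ := by
  intro γ γ' h
  refine trPosPart_mono (sub_smul_isHermitian hρ hσ.1 γ') ?_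
  have : ρ - (γ : ℂ) • σ - (ρ - (γ' : ℂ) • σ) = ((γ' - γ : ℝ) : ℂ) • σ := by
    push_cast; rw [sub_smul]; abel
  rw [this]
  exact ofReal_smul_posSemidef hσ (sub_nonneg.mpr h)

lemma hockeyStick_nonneg {ρ σ : Matrix d d ℂ} (hρ : ρ.IsHermitian) (hσ : σ.IsHermitian) (γ : ℝ) :
    0 ≤ hockeyStick γ ρ σ := trPosPart_nonneg (sub_smul_isHermitian hρ hσ γ)

lemma hockeyStick_le_one {ρ σ : Matrix d d ℂ} (hρ : IsState ρ) (hσ : σ.PosSemidef) {γ : ℝ}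
    (hγ : 0 ≤ γ) : hockeyStick γ ρ σ ≤ 1 := by
  have h := hockeyStick_antitone hρ.posSemidef.1 hσ hγ
  have h0 : hockeyStick 0 ρ σ = 1 := by
    rw [hockeyStick, Complex.ofReal_zero, zero_smul, sub_zero,
      trPosPart_of_posSemidef hρ.posSemidef, hρ.trace_re]
  simpa only [h0] using h

/-- Exchanging the roles of the two states. -/
lemma one_sub_hockeyStick_swap {ρ σ : Matrix d d ℂ} (hρ : IsState ρ) (hσ : IsState σ) {γ : ℝ}
    (hγ : 0 < γ) : 1 - hockeyStick γ σ ρ = γ * (1 - hockeyStick γ⁻¹ ρ σ) := by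
  have hH := sub_smul_isHermitian hσ.posSemidef.1 hρ.posSemidef.1 γ
  have h1 : ρ - ((γ⁻¹ : ℝ) : ℂ) • σ = ((γ⁻¹ : ℝ) : ℂ) • -(σ - (γ : ℂ) • ρ) := by
    have : (γ : ℂ) ≠ 0 := by exact_mod_cast hγ.ne'
    push_cast
    rw [neg_sub, smul_sub, smul_smul, inv_mul_cancel₀ this, one_smul]
  have h2 : (σ - (γ : ℂ) • ρ).trace.re = 1 - γ := by
    rw [trace_sub, trace_smul, Complex.sub_re, hσ.trace_re, hρ.trace_eq_one]; simp
  have h3 : hockeyStick γ⁻¹ ρ σ = γ⁻¹ * (hockeyStick γ σ ρ - (1 - γ)) := by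
    rw [hockeyStick, h1, trPosPart_smul hH.neg (inv_nonneg.mpr hγ.le), trPosPart_neg hH, h2]
    rfl
  rw [h3]
  field_simp
  ring

lemma hockeyStick_one_comm {ρ σ : Matrix d d ℂ} (hρ : IsState ρ) (hσ : IsState σ) :
    hockeyStick 1 ρ σ = hockeyStick 1 σ ρ := by
  have := one_sub_hockeyStick_swap hρ hσ one_pos
  simp at this
  linarith

lemma errorProb_eq {ρ σ : Matrix d d ℂ} (hρ : IsState ρ) (hσ : IsState σ) :
    errorProb ρ σ = 1 - hockeyStick 1 ρ σ := by
  have hH := hρ.posSemidef.1.sub hσ.posSemidef.1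
  rw [errorProb, trAbs_eq hH, trace_sub, Complex.sub_re, hρ.trace_re, hσ.trace_re, hockeyStick,
    Complex.ofReal_one, one_smul]
  ring

end HockeyStick

/-! ### Power-weighted integrals of antitone functions -/

section PowerIntegrals

lemma integrableOn_rpow_mul_antitone {g : ℝ → ℝ} (hg : Antitone g) (hg0 : ∀ x, 0 ≤ g x) {s : ℝ}
    (hs : s < -1) : IntegrableOn (fun x : ℝ => x ^ s * g x) (Ioi 1) := by
  have h1 : IntegrableOn (fun x : ℝ => x ^ s) (Ioi 1) := integrableOn_Ioi_rpow_of_lt hs one_pos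
  refine Integrable.mono' (h1.mul_const (g 1)) ?_ ?_
  · exact (h1.aestronglyMeasurable).mul hg.measurable.aestronglyMeasurable
  · refine (ae_restrict_iff' measurableSet_Ioi).mpr (ae_of_all _ fun x hx => ?_)
    have hx1 : (1 : ℝ) < x := hx
    have h2 : 0 ≤ x ^ s := Real.rpow_nonneg (by linarith) s
    rw [norm_mul, Real.norm_of_nonneg h2, Real.norm_of_nonneg (hg0 x)]
    exact mul_le_mul_of_nonneg_left (hg hx1.le) h2

lemma integral_rpow_mul_antitone_le {g : ℝ → ℝ} (hg : Antitone g) (hg0 : ∀ x, 0 ≤ g x) {s : ℝ}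
    (hs : s < -1) : ∫ x in Ioi (1 : ℝ), x ^ s * g x ≤ g 1 / (-(s + 1)) := by
  have h1 : IntegrableOn (fun x : ℝ => x ^ s) (Ioi 1) := integrableOn_Ioi_rpow_of_lt hs one_pos
  calc ∫ x in Ioi (1 : ℝ), x ^ s * g x ≤ ∫ x in Ioi (1 : ℝ), x ^ s * g 1 := by
        refine setIntegral_mono_on (integrableOn_rpow_mul_antitone hg hg0 hs) (h1.mul_const _)
          measurableSet_Ioi fun x hx => ?_
        have hx1 : (1 : ℝ) < x := hx
        exact mul_le_mul_of_nonneg_left (hg hx1.le) (Real.rpow_nonneg (by linarith) s)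
    _ = _ := by
        rw [integral_mul_const, integral_Ioi_rpow_of_lt hs one_pos, Real.one_rpow,
          div_neg, neg_div]
        ring

lemma integral_rpow_mul_nonneg {g : ℝ → ℝ} (hg0 : ∀ x, 0 ≤ g x) (s : ℝ) :
    0 ≤ ∫ x in Ioi (1 : ℝ), x ^ s * g x :=
  setIntegral_nonneg measurableSet_Ioi fun x hx =>
    mul_nonneg (Real.rpow_nonneg (zero_le_one.trans (le_of_lt hx)) s) (hg0 x)

/-- The substitution `x ↦ x^β` moves `β` from the weight into the argument of `g`, where
monotonicity in `β` is visible. -/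
lemma mul_integral_rpow_eq (g : ℝ → ℝ) {β : ℝ} (hβ : 0 < β) :
    β * ∫ x in Ioi (1 : ℝ), x ^ (-1 - β) * g x =
      ∫ x in Ioi (1 : ℝ), x ^ (-2 : ℝ) * g (x ^ β⁻¹) := by
  have h := integral_comp_rpow_Ioi
    ((Ioi (1 : ℝ)).indicator fun x : ℝ => x ^ (-2 : ℝ) * g (x ^ β⁻¹)) hβ.ne'
  have hI : Ioi (0 : ℝ) ∩ Ioi 1 = Ioi 1 := by rw [Ioi_inter_Ioi]; simp
  rw [setIntegral_indicator measurableSet_Ioi, hI] at h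
  rw [← h, ← integral_const_mul]
  have h2 : ∫ x in Ioi (1 : ℝ), β * (x ^ (-1 - β) * g x) = ∫ x in Ioi (0 : ℝ),
      (Ioi (1 : ℝ)).indicator (fun x => β * (x ^ (-1 - β) * g x)) x := by
    rw [setIntegral_indicator measurableSet_Ioi, hI]
  rw [h2]
  refine setIntegral_congr_fun measurableSet_Ioi fun x hx => ?_
  have hx0 : (0 : ℝ) < x := hx
  simp only [indicator_apply, mem_Ioi, smul_eq_mul, abs_of_pos hβ, Real.one_lt_rpow_iff_of_pos hx0]
  by_cases hx1 : 1 < x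
  · have h3 : ¬ (x < 1 ∧ β < 0) := by rintro ⟨h, _⟩; linarith
    rw [if_pos hx1, if_pos (Or.inl ⟨hx1, hβ⟩), ← Real.rpow_mul hx0.le, ← Real.rpow_mul hx0.le,
      mul_inv_cancel₀ hβ.ne', Real.rpow_one, ← mul_assoc, ← mul_assoc, mul_assoc β (x ^ (β - 1)),
      ← Real.rpow_add hx0]
    congr 3
    ring
  · rw [if_neg hx1, if_neg, mul_zero]
    rintro (⟨h, _⟩ | ⟨_, h⟩) <;> linarith

/-- An Abelian limit: `β ∫₁^∞ x^{-1-β} g(x) dx` converges as `β → 0⁺` for `g ≥ 0` antitone. -/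
lemma exists_tendsto_mul_integral_rpow {g : ℝ → ℝ} (hg : Antitone g) (hg0 : ∀ x, 0 ≤ g x) :
    ∃ L, Tendsto (fun β : ℝ => β * ∫ x in Ioi (1 : ℝ), x ^ (-1 - β) * g x) (𝓝[>] 0) (𝓝 L) := by
  refine ⟨_, MonotoneOn.tendsto_nhdsGT ?_ ⟨0, ?_⟩⟩
  · intro β hβ β' hβ' h
    have hβ : (0 : ℝ) < β := hβ
    have hβ' : (0 : ℝ) < β' := hβ'
    have hint : ∀ β : ℝ, 0 < β →
        IntegrableOn (fun x : ℝ => x ^ (-2 : ℝ) * g (x ^ β⁻¹)) (Ioi 1) := by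
      intro β hβ
      have h1 : IntegrableOn (fun x : ℝ => x ^ (-2 : ℝ)) (Ioi 1) :=
        integrableOn_Ioi_rpow_of_lt (by norm_num) one_pos
      refine Integrable.mono' (h1.mul_const (g 0)) ?_ ?_
      · exact h1.aestronglyMeasurable.mul
          (hg.measurable.comp (measurable_id.pow_const _)).aestronglyMeasurable
      · refine (ae_restrict_iff' measurableSet_Ioi).mpr (ae_of_all _ fun x hx => ?_)
        have hx0 : (0 : ℝ) ≤ x := zero_le_one.trans (le_of_lt hx)
        have h2 : 0 ≤ x ^ (-2 : ℝ) := Real.rpow_nonneg hx0 _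
        rw [norm_mul, Real.norm_of_nonneg h2, Real.norm_of_nonneg (hg0 _)]
        exact mul_le_mul_of_nonneg_left (hg (Real.rpow_nonneg hx0 _)) h2
    simp only
    -- For `x > 1`, `x^(1/β)` decreases in `β`, so the integral increases in `β`; being nonnegative,
    -- it has a limit at `0⁺`.
    rw [mul_integral_rpow_eq g hβ, mul_integral_rpow_eq g hβ']
    refine setIntegral_mono_on (hint β hβ) (hint β' hβ') measurableSet_Ioi fun x hx => ?_
    have hx1 : (1 : ℝ) < x := hx
    refine mul_le_mul_of_nonneg_left (hg ?_) (Real.rpow_nonneg (by linarith) _)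
    exact Real.rpow_le_rpow_of_exponent_le hx1.le (inv_anti₀ hβ h)
  · rintro _ ⟨β, hβ, rfl⟩
    exact mul_nonneg (le_of_lt hβ) (integral_rpow_mul_nonneg hg0 _)

end PowerIntegrals

/-! ### The Hellinger divergence: integral formula, symmetry and upper bound -/

section Hellinger

variable {d : Type*} [Fintype d] [DecidableEq d]

lemma deriv_deriv_hellingerFun {α : ℝ} (hα : α ≠ 1) {x : ℝ} (hx : 0 < x) :
    deriv (deriv (hellingerFun α)) x = α * x ^ (α - 2) := by
  have hα' : α - 1 ≠ 0 := sub_ne_zero.mpr hα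
  have h1 : ∀ y : ℝ, 0 < y → deriv (hellingerFun α) y = α / (α - 1) * y ^ (α - 1) := by
    intro y hy
    have := ((Real.hasDerivAt_rpow_const (x := y) (p := α) (Or.inl hy.ne')).sub_const 1).div_const
      (α - 1)
    have h2 : deriv (hellingerFun α) y = α * y ^ (α - 1) / (α - 1) := this.deriv
    rw [h2]; ring
  have h2 : deriv (hellingerFun α) =ᶠ[𝓝 x] fun y => α / (α - 1) * y ^ (α - 1) := by
    filter_upwards [lt_mem_nhds hx] with y hy using h1 y hy
  rw [h2.deriv_eq]
  have h3 := (Real.hasDerivAt_rpow_const (x := x) (p := α - 1) (Or.inl hx.ne')).const_mul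
    (α / (α - 1))
  rw [h3.deriv, show α - 1 - 1 = α - 2 by ring]
  field_simp

lemma fDivIntegrand_hellingerFun {α : ℝ} (hα : α ≠ 1) (ρ σ : Matrix d d ℂ) {γ : ℝ} (hγ : 0 < γ) :
    fDivIntegrand (hellingerFun α) ρ σ γ =
      α * (γ ^ (α - 2) * hockeyStick γ ρ σ + γ ^ (-1 - α) * hockeyStick γ σ ρ) := by
  rw [fDivIntegrand, deriv_deriv_hellingerFun hα hγ, deriv_deriv_hellingerFun hα (inv_pos.mpr hγ)]
  have : γ⁻¹ ^ 3 * (α * γ⁻¹ ^ (α - 2)) = α * γ ^ (-1 - α) := by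
    rw [Real.inv_rpow hγ.le, ← Real.rpow_neg hγ.le, ← Real.rpow_neg_one, ← Real.rpow_natCast,
      ← Real.rpow_mul hγ.le, mul_left_comm, ← Real.rpow_add hγ]
    congr 2
    push_cast; ring
  rw [this]
  ring

lemma integrableOn_fDivIntegrand {ρ σ : Matrix d d ℂ} (hρ : ρ.PosSemidef) (hσ : σ.PosSemidef)
    {α : ℝ} (hα : α ∈ Ioo (0 : ℝ) 1) :
    IntegrableOn (fDivIntegrand (hellingerFun α) ρ σ) (Ioi 1) := by
  have h1 := integrableOn_rpow_mul_antitone (hockeyStick_antitone hρ.1 hσ)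
    (hockeyStick_nonneg hρ.1 hσ.1) (s := α - 2) (by linarith [hα.2])
  have h2 := integrableOn_rpow_mul_antitone (hockeyStick_antitone hσ.1 hρ)
    (hockeyStick_nonneg hσ.1 hρ.1) (s := -1 - α) (by linarith [hα.1])
  refine (integrableOn_congr_fun (fun γ hγ => ?_) measurableSet_Ioi).mpr ((h1.add h2).const_mul α)
  exact fDivIntegrand_hellingerFun hα.2.ne ρ σ (zero_lt_one.trans hγ)

lemma hellinger_eq {ρ σ : Matrix d d ℂ} (hρ : ρ.PosSemidef) (hσ : σ.PosSemidef)
    {α : ℝ} (hα : α ∈ Ioo (0 : ℝ) 1) :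
    hellinger α ρ σ = α * (∫ γ in Ioi (1 : ℝ), γ ^ (α - 2) * hockeyStick γ ρ σ) +
      α * ∫ γ in Ioi (1 : ℝ), γ ^ (-1 - α) * hockeyStick γ σ ρ := by
  have h1 := integrableOn_rpow_mul_antitone (hockeyStick_antitone hρ.1 hσ)
    (hockeyStick_nonneg hρ.1 hσ.1) (s := α - 2) (by linarith [hα.2])
  have h2 := integrableOn_rpow_mul_antitone (hockeyStick_antitone hσ.1 hρ)
    (hockeyStick_nonneg hσ.1 hρ.1) (s := -1 - α) (by linarith [hα.1])
  rw [hellinger, fDiv, ← mul_add, ← integral_add h1 h2, ← integral_const_mul]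
  exact setIntegral_congr_fun measurableSet_Ioi fun γ hγ =>
    fDivIntegrand_hellingerFun hα.2.ne ρ σ (zero_lt_one.trans hγ)

lemma hellinger_swap {ρ σ : Matrix d d ℂ} (hρ : ρ.PosSemidef) (hσ : σ.PosSemidef)
    {α : ℝ} (hα : α ∈ Ioo (0 : ℝ) 1) :
    (1 - α) * hellinger α ρ σ = (1 - (1 - α)) * hellinger (1 - α) σ ρ := by
  rw [hellinger_eq hρ hσ hα, hellinger_eq hσ hρ ⟨by linarith [hα.2], by linarith [hα.1]⟩,
    show 1 - α - 2 = -1 - α by ring, show -1 - (1 - α) = α - 2 by ring]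
  ring

/-- Replacing each divergence by its value at `γ = 1` bounds the two halves of `(1 - α) H_α` by `α
E_1` and `(1 - α) E_1`, since `E_1` is symmetric in the two states. -/
lemma hellinger_le {ρ σ : Matrix d d ℂ} (hρ : IsState ρ) (hσ : IsState σ)
    {α : ℝ} (hα : α ∈ Ioo (0 : ℝ) 1) :
    (1 - α) * hellinger α ρ σ ≤ hockeyStick 1 ρ σ := by
  have h1 := integral_rpow_mul_antitone_le (hockeyStick_antitone hρ.posSemidef.1 hσ.posSemidef)
    (hockeyStick_nonneg hρ.posSemidef.1 hσ.posSemidef.1) (s := α - 2) (by linarith [hα.2])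
  have h2 := integral_rpow_mul_antitone_le (hockeyStick_antitone hσ.posSemidef.1 hρ.posSemidef)
    (hockeyStick_nonneg hσ.posSemidef.1 hρ.posSemidef.1) (s := -1 - α) (by linarith [hα.1])
  have hα0 := hα.1
  have hα1 : 0 < 1 - α := by linarith [hα.2]
  rw [show -(α - 2 + 1) = 1 - α by ring, le_div_iff₀ hα1] at h1
  rw [show -(-1 - α + 1) = α by ring, le_div_iff₀ hα0, ← hockeyStick_one_comm hρ hσ] at h2
  rw [hellinger_eq hρ.posSemidef hσ.posSemidef hα]
  nlinarith [mul_le_mul_of_nonneg_left h1 hα0.le, mul_le_mul_of_nonneg_left h2 hα1.le]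

end Hellinger

end QDiv

namespace QDiv

open Matrix MeasureTheory Set Filter

/-! ### Comparison with `Tr[ρ^α σ^(1-α)]`, and the endpoints -/

section PetzBound

variable {d : Type*} [Fintype d] [DecidableEq d]

lemma petzTrace_spec_of_mem_Ioo (U V : unitaryGroup d ℂ) (a b : d → ℝ) {α : ℝ}
    (hα : α ∈ Ioo (0 : ℝ) 1) : petzTrace α (spec U a) (spec V b) =
      ∑ i, ∑ j, a i ^ α * b j ^ (1 - α) * overlap U V i j := by
  rw [petzTrace_spec]
  refine Finset.sum_congr rfl fun i _ => Finset.sum_congr rfl fun j _ => ?_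
  congr 2
  · split_ifs with h
    · rw [h, Real.zero_rpow hα.1.ne']
    · rfl
  · split_ifs with h
    · rw [h, Real.zero_rpow (by linarith [hα.2])]
    · rfl

lemma petzTrace_nonneg {ρ σ : Matrix d d ℂ} (hρ : ρ.PosSemidef) (hσ : σ.PosSemidef) (α : ℝ) :
    0 ≤ petzTrace α ρ σ := by
  obtain ⟨U, a, ha, rfl⟩ := PosSemidef.exists_spec hρ
  obtain ⟨V, b, hb, rfl⟩ := PosSemidef.exists_spec hσ
  rw [petzTrace_spec]
  refine Finset.sum_nonneg fun i _ => Finset.sum_nonneg fun j _ =>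
    mul_nonneg (mul_nonneg ?_ ?_) (overlap_nonneg _ _ _ _)
  · split_ifs
    exacts [le_rfl, Real.rpow_nonneg (ha i) _]
  · split_ifs
    exacts [le_rfl, Real.rpow_nonneg (hb j) _]

lemma petzTrace_swap (ρ σ : Matrix d d ℂ) (α : ℝ) :
    petzTrace (1 - α) σ ρ = petzTrace α ρ σ := by
  rw [petzTrace, petzTrace, trace_mul_comm, show 1 - (1 - α) = α by ring]

/-- Zero eigenvalues contribute zero for every exponent, so the support convention is what gives
continuity at `α = 0` and `α = 1` too. -/
lemma continuous_petzTrace {ρ σ : Matrix d d ℂ} (hρ : ρ.PosSemidef) (hσ : σ.PosSemidef) :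
    Continuous fun α => petzTrace α ρ σ := by
  obtain ⟨U, a, ha, rfl⟩ := PosSemidef.exists_spec hρ
  obtain ⟨V, b, hb, rfl⟩ := PosSemidef.exists_spec hσ
  simp only [petzTrace_spec]
  have h : ∀ x : ℝ, Continuous fun s : ℝ => if x = 0 then (0 : ℝ) else x ^ s := by
    intro x
    split_ifs with hx
    · exact continuous_const
    · exact Real.continuous_const_rpow hx
  refine continuous_finsetSum _ fun i _ => continuous_finsetSum _ fun j _ => ?_
  exact ((h (a i)).mul ((h (b j)).comp (continuous_const.sub continuous_id))).mul continuous_const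

/-- Replace `σ` by `σ + ε`: the left side can only grow, as the positive part is monotone, and the
right side is continuous in `ε`. -/
lemma lintegral_trace_min_le {ρ σ : Matrix d d ℂ} (hρ : IsState ρ) (hσ : σ.PosSemidef)
    {α : ℝ} (hα : 0 < α) (hα1 : α ≤ 1 / 2) :
    ∫⁻ t in Ioi (0 : ℝ), ENNReal.ofReal (t ^ (α - 2) * (1 - hockeyStick t ρ σ)) ≤
      ENNReal.ofReal (1 / (α * (1 - α)) * petzTrace α ρ σ) := by
  have htr := hρ.trace_re
  obtain ⟨U, a, ha, rfl⟩ := PosSemidef.exists_spec hρ.posSemidef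
  obtain ⟨V, b, hb, rfl⟩ := PosSemidef.exists_spec hσ
  rw [trace_spec] at htr
  rw [petzTrace_spec_of_mem_Ioo U V a b ⟨hα, by linarith⟩]
  have hlim : Tendsto (fun ε : ℝ => ENNReal.ofReal (1 / (α * (1 - α)) *
      ∑ i, ∑ j, a i ^ α * (b j + ε) ^ (1 - α) * overlap U V i j)) (𝓝[>] 0)
      (𝓝 (ENNReal.ofReal (1 / (α * (1 - α)) *
      ∑ i, ∑ j, a i ^ α * b j ^ (1 - α) * overlap U V i j))) := by
    have hc : Continuous fun ε : ℝ => ENNReal.ofReal (1 / (α * (1 - α)) *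
        ∑ i, ∑ j, a i ^ α * (b j + ε) ^ (1 - α) * overlap U V i j) := by
      refine ENNReal.continuous_ofReal.comp (continuous_const.mul ?_)
      refine continuous_finsetSum _ fun i _ => continuous_finsetSum _ fun j _ => ?_
      have : Continuous fun ε : ℝ => (b j + ε) ^ (1 - α) :=
        Continuous.rpow_const (by fun_prop) fun _ => Or.inr (by linarith)
      fun_prop
    have := (hc.tendsto 0).mono_left (nhdsWithin_le_nhds (s := Ioi 0))
    simpa only [add_zero] using this
  refine ge_of_tendsto hlim ?_
  filter_upwards [self_mem_nhdsWithin] with ε hε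
  have hε : (0 : ℝ) < ε := hε
  refine le_trans ?_ (lintegral_trace_min_le_of_pos U V a (fun j => b j + ε) ha
    (fun j => by have := hb j; positivity) hα hα1)
  refine setLIntegral_mono' measurableSet_Ioi fun t ht => ?_
  have ht : (0 : ℝ) < t := ht
  refine ENNReal.ofReal_le_ofReal (mul_le_mul_of_nonneg_left ?_ (Real.rpow_nonneg ht.le _))
  rw [htr]
  refine sub_le_sub_left (trPosPart_mono (sub_smul_isHermitian (spec_isHermitian _ _)
    (spec_isHermitian _ _) t) ?_) 1
  rw [sub_sub_sub_cancel_left, ← smul_sub, spec_sub, spec_smul]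
  refine spec_posSemidef _ fun i => ?_
  simp only [add_sub_cancel_left]
  positivity

/-- The substitution `t = 1 / γ` combined with `one_sub_hockeyStick_swap`. -/
lemma lintegral_hockeyStick_swap {ρ σ : Matrix d d ℂ} (hρ : IsState ρ) (hσ : IsState σ) (α : ℝ) :
    ∫⁻ γ in Ioi (1 : ℝ), ENNReal.ofReal (γ ^ (-1 - α) * (1 - hockeyStick γ σ ρ)) =
      ∫⁻ t in Ioo (0 : ℝ) 1, ENNReal.ofReal (t ^ (α - 2) * (1 - hockeyStick t ρ σ)) := by
  have himg : (fun x : ℝ => x⁻¹) '' Ioi 1 = Ioo 0 1 := by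
    rw [image_inv_eq_inv, inv_Ioi₀ one_pos, inv_one]
  rw [← himg, lintegral_image_eq_lintegral_abs_deriv_mul measurableSet_Ioi
    (fun x hx => (hasDerivAt_inv (zero_lt_one.trans (mem_Ioi.mp hx)).ne').hasDerivWithinAt)
    inv_injective.injOn]
  refine setLIntegral_congr_fun measurableSet_Ioi fun γ hγ => ?_
  have hγ0 : (0 : ℝ) < γ := zero_lt_one.trans hγ
  rw [← ENNReal.ofReal_mul (abs_nonneg _), one_sub_hockeyStick_swap hρ hσ hγ0]
  congr 1
  rw [abs_neg, abs_of_pos (inv_pos.mpr (pow_pos hγ0 2)), ← mul_assoc, ← mul_assoc]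
  congr 1
  rw [Real.inv_rpow hγ0.le, ← Real.rpow_neg hγ0.le, ← Real.rpow_natCast, ← Real.rpow_neg hγ0.le,
    ← Real.rpow_add hγ0, ← Real.rpow_add_one hγ0.ne']
  congr 1
  push_cast; ring

lemma one_sub_hellinger_le_petzTrace_of_le_half {ρ σ : Matrix d d ℂ} (hρ : IsState ρ)
    (hσ : IsState σ) {α : ℝ} (hα : 0 < α) (hα1 : α ≤ 1 / 2) :
    1 - (1 - α) * hellinger α ρ σ ≤ petzTrace α ρ σ := by
  have hα' : 0 < 1 - α := by linarith
  have hs1 : α - 2 < -1 := by linarith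
  have hs2 : -1 - α < -1 := by linarith
  have hA := hockeyStick_antitone hρ.posSemidef.1 hσ.posSemidef
  have hB := hockeyStick_antitone hσ.posSemidef.1 hρ.posSemidef
  have p1 := integrableOn_Ioi_rpow_of_lt hs1 one_pos
  have p2 := integrableOn_Ioi_rpow_of_lt hs2 one_pos
  have i1 := integrableOn_rpow_mul_antitone hA
    (hockeyStick_nonneg hρ.posSemidef.1 hσ.posSemidef.1) hs1
  have i2 := integrableOn_rpow_mul_antitone hB
    (hockeyStick_nonneg hσ.posSemidef.1 hρ.posSemidef.1) hs2
  have j1 : IntegrableOn (fun γ : ℝ => γ ^ (α - 2) * (1 - hockeyStick γ ρ σ)) (Ioi 1) := by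
    simp only [mul_sub, mul_one]; exact p1.sub i1
  have j2 : IntegrableOn (fun γ : ℝ => γ ^ (-1 - α) * (1 - hockeyStick γ σ ρ)) (Ioi 1) := by
    simp only [mul_sub, mul_one]; exact p2.sub i2
  have v1 : ∫ γ in Ioi (1 : ℝ), γ ^ (α - 2) * (1 - hockeyStick γ ρ σ) =
      1 / (1 - α) - ∫ γ in Ioi (1 : ℝ), γ ^ (α - 2) * hockeyStick γ ρ σ := by
    simp only [mul_sub, mul_one]
    rw [integral_sub p1 i1, integral_Ioi_rpow_of_lt hs1 one_pos, Real.one_rpow,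
      show α - 2 + 1 = -(1 - α) by ring, neg_div_neg_eq]
  have v2 : ∫ γ in Ioi (1 : ℝ), γ ^ (-1 - α) * (1 - hockeyStick γ σ ρ) =
      1 / α - ∫ γ in Ioi (1 : ℝ), γ ^ (-1 - α) * hockeyStick γ σ ρ := by
    simp only [mul_sub, mul_one]
    rw [integral_sub p2 i2, integral_Ioi_rpow_of_lt hs2 one_pos, Real.one_rpow,
      show -1 - α + 1 = -α by ring, neg_div_neg_eq]
  have n1 : ∀ γ ∈ Ioi (1 : ℝ), 0 ≤ γ ^ (α - 2) * (1 - hockeyStick γ ρ σ) := fun γ hγ => by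
    have h0 : (0 : ℝ) ≤ γ := zero_le_one.trans (le_of_lt hγ)
    exact mul_nonneg (Real.rpow_nonneg h0 _)
      (sub_nonneg.mpr (hockeyStick_le_one hρ hσ.posSemidef h0))
  have n2 : ∀ γ ∈ Ioi (1 : ℝ), 0 ≤ γ ^ (-1 - α) * (1 - hockeyStick γ σ ρ) := fun γ hγ => by
    have h0 : (0 : ℝ) ≤ γ := zero_le_one.trans (le_of_lt hγ)
    exact mul_nonneg (Real.rpow_nonneg h0 _)
      (sub_nonneg.mpr (hockeyStick_le_one hσ hρ.posSemidef h0))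
  set I₁ := ∫ γ in Ioi (1 : ℝ), γ ^ (α - 2) * (1 - hockeyStick γ ρ σ)
  set I₂ := ∫ γ in Ioi (1 : ℝ), γ ^ (-1 - α) * (1 - hockeyStick γ σ ρ)
  -- `I₁` covers `t > 1` and `I₂`, after inversion, `0 < t < 1`. As `1/α + 1/(1-α) = 1/(α(1-α))`,
  -- their sum is `(1 - (1 - α) H_α) / (α (1 - α))`.
  have key : ENNReal.ofReal (I₁ + I₂) ≤
      ENNReal.ofReal (1 / (α * (1 - α)) * petzTrace α ρ σ) := by
    rw [ENNReal.ofReal_add (setIntegral_nonneg measurableSet_Ioi n1)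
      (setIntegral_nonneg measurableSet_Ioi n2),
      ofReal_integral_eq_lintegral_ofReal j1
        ((ae_restrict_iff' measurableSet_Ioi).mpr (ae_of_all _ n1)),
      ofReal_integral_eq_lintegral_ofReal j2
        ((ae_restrict_iff' measurableSet_Ioi).mpr (ae_of_all _ n2)),
      lintegral_hockeyStick_swap hρ hσ α, add_comm]
    refine le_trans ?_ (lintegral_trace_min_le hρ hσ.posSemidef hα hα1)
    rw [← lintegral_union measurableSet_Ioi]
    · refine lintegral_mono_set ?_
      rintro t (ht | ht)
      · exact ht.1
      · exact zero_lt_one.trans (mem_Ioi.mp ht)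
    · rw [Set.disjoint_left]
      intro t ht ht'
      exact lt_asymm ht.2 ht'
  have hp := petzTrace_nonneg hρ.posSemidef hσ.posSemidef α
  rw [ENNReal.ofReal_le_ofReal_iff (by positivity), one_div, ← div_eq_inv_mul,
    le_div_iff₀ (by positivity), v1, v2] at key
  rw [hellinger_eq hρ.posSemidef hσ.posSemidef ⟨hα, by linarith⟩]
  refine le_trans (le_of_eq ?_) key
  field_simp
  ring

theorem one_sub_hellinger_le_petzTrace {ρ σ : Matrix d d ℂ} (hρ : IsState ρ)
    (hσ : IsState σ) {α : ℝ} (hα : α ∈ Ioo (0 : ℝ) 1) :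
    1 - (1 - α) * hellinger α ρ σ ≤ petzTrace α ρ σ := by
  rcases le_total α (1 / 2) with h | h
  · exact one_sub_hellinger_le_petzTrace_of_le_half hρ hσ hα.1 h
  · rw [hellinger_swap hρ.posSemidef hσ.posSemidef hα, ← petzTrace_swap]
    exact one_sub_hellinger_le_petzTrace_of_le_half hσ hρ (by linarith [hα.2]) (by linarith)

lemma one_sub_mul_petzHellinger (ρ σ : Matrix d d ℂ) {α : ℝ} (hα : α ≠ 1) :
    (1 - α) * petzHellinger α ρ σ = 1 - petzTrace α ρ σ := by
  have : 1 - α ≠ 0 := sub_ne_zero.mpr hα.symm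
  rw [petzHellinger]
  field_simp

lemma tendsto_one_sub_mul_petzHellinger {ρ σ : Matrix d d ℂ} (hρ : ρ.PosSemidef)
    (hσ : σ.PosSemidef) (α : ℝ) :
    Tendsto (fun β => (1 - β) * petzHellinger β ρ σ) (𝓝[Ioo 0 1] α)
      (𝓝 (1 - petzTrace α ρ σ)) := by
  have h := ((continuous_petzTrace hρ hσ).tendsto α).const_sub 1
  refine (h.mono_left nhdsWithin_le_nhds).congr' ?_
  filter_upwards [self_mem_nhdsWithin] with β hβ
  rw [one_sub_mul_petzHellinger ρ σ hβ.2.ne]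

/-- The part with `E_γ(ρ‖σ)` is squeezed between `0` and `β E_1` and vanishes; the part with
`E_γ(σ‖ρ)` converges by the Abelian limit. -/
lemma exists_tendsto_hellinger_zero {ρ σ : Matrix d d ℂ} (hρ : IsState ρ) (hσ : IsState σ) :
    ∃ h, Tendsto (fun β => (1 - β) * hellinger β ρ σ) (𝓝[Ioo 0 1] 0) (𝓝 h) := by
  have hA := hockeyStick_antitone hρ.posSemidef.1 hσ.posSemidef
  have hA0 := hockeyStick_nonneg hρ.posSemidef.1 hσ.posSemidef.1
  obtain ⟨L, hL⟩ := exists_tendsto_mul_integral_rpow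
    (hockeyStick_antitone hσ.posSemidef.1 hρ.posSemidef)
    (hockeyStick_nonneg hσ.posSemidef.1 hρ.posSemidef.1)
  have hL' := hL.mono_left (nhdsWithin_mono 0 (fun x (hx : x ∈ Ioo (0 : ℝ) 1) => hx.1))
  have hid : Tendsto (fun β : ℝ => β) (𝓝[Ioo 0 1] 0) (𝓝 0) :=
    tendsto_id.mono_left nhdsWithin_le_nhds
  have h1 : Tendsto (fun β : ℝ => (1 - β) *
      (β * ∫ γ in Ioi (1 : ℝ), γ ^ (β - 2) * hockeyStick γ ρ σ)) (𝓝[Ioo 0 1] 0) (𝓝 0) := by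
    have hu : Tendsto (fun β : ℝ => β * hockeyStick 1 ρ σ) (𝓝[Ioo 0 1] 0) (𝓝 0) := by
      simpa using hid.mul_const (hockeyStick 1 ρ σ)
    refine tendsto_of_tendsto_of_tendsto_of_le_of_le' tendsto_const_nhds hu ?_ ?_
    · filter_upwards [self_mem_nhdsWithin] with β hβ
      exact mul_nonneg (sub_nonneg.mpr hβ.2.le)
        (mul_nonneg hβ.1.le (integral_rpow_mul_nonneg hA0 _))
    · filter_upwards [self_mem_nhdsWithin] with β hβ
      have h := integral_rpow_mul_antitone_le hA hA0 (s := β - 2) (by linarith [hβ.2])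
      rw [show -(β - 2 + 1) = 1 - β by ring, le_div_iff₀ (by linarith [hβ.2])] at h
      calc _ = β * ((∫ γ in Ioi (1 : ℝ), γ ^ (β - 2) * hockeyStick γ ρ σ) * (1 - β)) := by ring
        _ ≤ _ := mul_le_mul_of_nonneg_left h hβ.1.le
  have h2 := h1.add ((hid.const_sub 1).mul hL')
  refine ⟨_, h2.congr' ?_⟩
  filter_upwards [self_mem_nhdsWithin] with β hβ
  rw [hellinger_eq hρ.posSemidef hσ.posSemidef hβ]
  ring

lemma exists_tendsto_hellinger_one {ρ σ : Matrix d d ℂ} (hρ : IsState ρ) (hσ : IsState σ) :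
    ∃ h, Tendsto (fun β => (1 - β) * hellinger β ρ σ) (𝓝[Ioo 0 1] 1) (𝓝 h) := by
  obtain ⟨h, hh⟩ := exists_tendsto_hellinger_zero hσ hρ
  have hmap : Tendsto (fun β : ℝ => 1 - β) (𝓝[Ioo 0 1] 1) (𝓝[Ioo 0 1] 0) := by
    refine tendsto_nhdsWithin_iff.mpr ⟨?_, ?_⟩
    · have : Tendsto (fun β : ℝ => 1 - β) (𝓝 1) (𝓝 (1 - 1)) :=
        (continuous_const.sub continuous_id).tendsto 1
      rw [sub_self] at this
      exact this.mono_left nhdsWithin_le_nhds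
    · filter_upwards [self_mem_nhdsWithin] with β hβ
      exact ⟨by linarith [hβ.2], by linarith [hβ.1]⟩
  refine ⟨h, (hh.comp hmap).congr' ?_⟩
  filter_upwards [self_mem_nhdsWithin] with β hβ
  exact (hellinger_swap hρ.posSemidef hσ.posSemidef hβ).symm

lemma exists_tendsto_hellinger {ρ σ : Matrix d d ℂ} (hρ : IsState ρ) (hσ : IsState σ) {α : ℝ}
    (hα : α = 0 ∨ α = 1) :
    ∃ h, Tendsto (fun β => (1 - β) * hellinger β ρ σ) (𝓝[Ioo 0 1] α) (𝓝 h) ∧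
      1 - petzTrace α ρ σ ≤ h ∧ h ≤ hockeyStick 1 ρ σ := by
  have hex : ∃ h, Tendsto (fun β => (1 - β) * hellinger β ρ σ) (𝓝[Ioo 0 1] α) (𝓝 h) := by
    rcases hα with rfl | rfl
    exacts [exists_tendsto_hellinger_zero hρ hσ, exists_tendsto_hellinger_one hρ hσ]
  have hne : (𝓝[Ioo (0 : ℝ) 1] α).NeBot := by
    rw [← mem_closure_iff_nhdsWithin_neBot, closure_Ioo zero_ne_one]
    rcases hα with rfl | rfl <;> simp
  obtain ⟨h, hh⟩ := hex
  refine ⟨h, hh, ?_, ?_⟩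
  · refine le_of_tendsto_of_tendsto
      (tendsto_one_sub_mul_petzHellinger hρ.posSemidef hσ.posSemidef α) hh ?_
    filter_upwards [self_mem_nhdsWithin] with β hβ
    rw [one_sub_mul_petzHellinger ρ σ hβ.2.ne]
    linarith [one_sub_hellinger_le_petzTrace hρ hσ hβ]
  · refine le_of_tendsto hh ?_
    filter_upwards [self_mem_nhdsWithin] with β hβ
    exact hellinger_le hρ hσ hβ

/-- The inequality of Audenaert et al. -/
theorem errorProb_le_petzTrace {ρ σ : Matrix d d ℂ} (hρ : IsState ρ) (hσ : IsState σ) {α : ℝ}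
    (hα : α ∈ Icc (0 : ℝ) 1) : errorProb ρ σ ≤ petzTrace α ρ σ := by
  rw [errorProb_eq hρ hσ]
  by_cases h : α = 0 ∨ α = 1
  · obtain ⟨h, -, h1, h2⟩ := exists_tendsto_hellinger hρ hσ h
    linarith
  · push Not at h
    have hα' : α ∈ Ioo (0 : ℝ) 1 := ⟨hα.1.lt_of_ne' h.1, hα.2.lt_of_ne h.2⟩
    linarith [one_sub_hellinger_le_petzTrace hρ hσ hα', hellinger_le hρ hσ hα']

end PetzBound

/-! ### Tensor powers and multiplicativity -/

section TensorPower

variable {d : Type*}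

lemma tensorPow_mul [Fintype d] (n : ℕ) (A B : Matrix d d ℂ) :
    tensorPow n (A * B) = tensorPow n A * tensorPow n B := by
  ext i j
  simp only [tensorPow, of_apply, Matrix.mul_apply, Finset.prod_univ_sum, Fintype.piFinset_univ,
    Finset.prod_mul_distrib]

lemma tensorPow_conjTranspose (n : ℕ) (A : Matrix d d ℂ) :
    tensorPow n Aᴴ = (tensorPow n A)ᴴ := by
  ext i j
  simp [tensorPow, conjTranspose_apply]

lemma tensorPow_diagonal [DecidableEq d] (n : ℕ) (x : d → ℂ) :
    tensorPow n (diagonal x) = diagonal fun i => ∏ k, x (i k) := by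
  ext i j
  simp only [tensorPow, of_apply, diagonal_apply]
  split_ifs with h
  · subst h; simp
  · obtain ⟨k, hk⟩ := Function.ne_iff.mp h
    exact Finset.prod_eq_zero (Finset.mem_univ k) (if_neg hk)

lemma tensorPow_one [DecidableEq d] (n : ℕ) : tensorPow n (1 : Matrix d d ℂ) = 1 := by
  rw [← diagonal_one, tensorPow_diagonal, ← diagonal_one]; simp

lemma trace_tensorPow [Fintype d] (n : ℕ) (A : Matrix d d ℂ) : (tensorPow n A).trace = A.trace ^ n := by
  simp only [trace, diag, tensorPow, of_apply]
  rw [← Fintype.piFinset_univ, ← Finset.prod_univ_sum (fun _ => Finset.univ) fun _ j => A j j]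
  simp

variable [Fintype d] [DecidableEq d]

lemma exists_tensorPow_spec (n : ℕ) (U : unitaryGroup d ℂ) :
    ∃ U' : unitaryGroup (Fin n → d) ℂ, ∀ x : d → ℝ,
      tensorPow n (spec U x) = spec U' fun i => ∏ k, x (i k) := by
  refine ⟨⟨tensorPow n (U : Matrix d d ℂ), ?_⟩, fun x => ?_⟩
  · rw [mem_unitaryGroup_iff', star_eq_conjTranspose, ← tensorPow_conjTranspose, ← tensorPow_mul,
      conjTranspose_mul_unitary, tensorPow_one]
  · simp only [spec]
    rw [tensorPow_mul, tensorPow_mul, tensorPow_diagonal, tensorPow_conjTranspose]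
    simp only [Complex.ofReal_prod]

lemma tensorPow_mpow {A : Matrix d d ℂ} (hA : A.PosSemidef) (n : ℕ) (s : ℝ) :
    mpow (tensorPow n A) s = tensorPow n (mpow A s) := by
  obtain ⟨U, a, ha, rfl⟩ := PosSemidef.exists_spec hA
  obtain ⟨U', hU'⟩ := exists_tensorPow_spec n U
  rw [hU', mpow_spec, mpow_spec, hU']
  congr 1
  ext i
  by_cases h : ∃ k, a (i k) = 0
  · obtain ⟨k, hk⟩ := h
    rw [if_pos (Finset.prod_eq_zero (Finset.mem_univ k) hk)]
    symm
    apply Finset.prod_eq_zero (Finset.mem_univ k)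
    exact if_pos hk
  · push Not at h
    rw [if_neg (Finset.prod_ne_zero_iff.mpr fun k _ => h k),
      ← Real.finsetProd_rpow _ _ fun k _ => ha (i k)]
    exact Finset.prod_congr rfl fun k _ => (if_neg (h k)).symm

lemma IsState.tensorPow {ρ : Matrix d d ℂ} (hρ : IsState ρ) (n : ℕ) :
    IsState (tensorPow n ρ) := by
  constructor
  · obtain ⟨U, a, ha, h⟩ := PosSemidef.exists_spec hρ.posSemidef
    obtain ⟨U', hU'⟩ := exists_tensorPow_spec n U
    rw [h, hU']
    exact spec_posSemidef _ fun i => Finset.prod_nonneg fun k _ => ha _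
  · rw [trace_tensorPow, hρ.trace_eq_one, one_pow]

lemma petzTrace_tensorPow {ρ σ : Matrix d d ℂ} (hρ : ρ.PosSemidef) (hσ : σ.PosSemidef) (n : ℕ)
    (α : ℝ) : petzTrace α (tensorPow n ρ) (tensorPow n σ) = petzTrace α ρ σ ^ n := by
  -- The trace of a product of two Hermitian matrices is real, so taking real parts commutes with
  -- the `n`-th power.
  have him : (mpow ρ α * mpow σ (1 - α)).trace = (petzTrace α ρ σ : ℂ) := by
    refine Complex.ext rfl ?_
    rw [Complex.ofReal_im]
    have hH : ∀ (A : Matrix d d ℂ) (s : ℝ), A.PosSemidef → (mpow A s).IsHermitian := by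
      intro A s hA
      obtain ⟨U, a, ha, rfl⟩ := PosSemidef.exists_spec hA
      rw [mpow_spec]
      exact spec_isHermitian _ _
    rw [← Complex.conj_eq_iff_im, ← Complex.star_def, ← trace_conjTranspose, conjTranspose_mul,
      (hH ρ α hρ).eq, (hH σ _ hσ).eq, trace_mul_comm]
  rw [petzTrace, tensorPow_mpow hρ, tensorPow_mpow hσ, ← tensorPow_mul, trace_tensorPow, him]
  norm_cast

end TensorPower

/-! ### Attainment of the minimum and the Chernoff bound -/

section Chernoff

variable {d : Type*} [Fintype d] [DecidableEq d]

lemma elog_mono {x y : ℝ} (h : x ≤ y) : elog x ≤ elog y :=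
  ENNReal.log_monotone (ENNReal.ofReal_le_ofReal h)

lemma elog_pow {x : ℝ} (hx : 0 ≤ x) (n : ℕ) : elog (x ^ n) = n * elog x := by
  rw [elog, elog, ENNReal.ofReal_pow hx, ENNReal.log_pow]

lemma exists_chernoff_eq {ρ σ : Matrix d d ℂ} (hρ : ρ.PosSemidef) (hσ : σ.PosSemidef) :
    ∃ α ∈ Icc (0 : ℝ) 1, chernoff ρ σ = -elog (petzTrace α ρ σ) := by
  obtain ⟨α, hα, hmin⟩ := (isCompact_Icc (a := (0 : ℝ)) (b := 1)).exists_isMinOn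
    ⟨0, by simp⟩ (continuous_petzTrace hρ hσ).continuousOn
  refine ⟨α, hα, ?_⟩
  rw [chernoff]
  congr 1
  exact le_antisymm (iInf₂_le α hα) (le_iInf₂ fun β hβ => elog_mono (hmin hβ))

theorem chernoff_le {ρ σ : Matrix d d ℂ} (hρ : IsState ρ) (hσ : IsState σ) {n : ℕ} (hn : 1 ≤ n) :
    chernoff ρ σ ≤ -(elog (errorProb (tensorPow n ρ) (tensorPow n σ)) / (n : EReal)) := by
  obtain ⟨α, hα, h⟩ := exists_chernoff_eq hρ.posSemidef hσ.posSemidef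
  rw [h, EReal.neg_le_neg_iff]
  have h1 := errorProb_le_petzTrace (hρ.tensorPow n) (hσ.tensorPow n) hα
  rw [petzTrace_tensorPow hρ.posSemidef hσ.posSemidef] at h1
  have h2 := elog_mono h1
  rw [elog_pow (petzTrace_nonneg hρ.posSemidef hσ.posSemidef α)] at h2
  rw [EReal.div_le_iff_le_mul (by exact_mod_cast hn) (by exact EReal.natCast_ne_top n)]
  exact h2

end Chernoff

end QDiv

theorem mainTheorem4 {d : Type*} [Fintype d] [DecidableEq d] (ρ σ : Matrix d d ℂ)
    (hρ : QDiv.IsState ρ) (hσ : QDiv.IsState σ) :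
    -- `E_1` is the trace of the positive part of `ρ - σ`
    QDiv.hockeyStick 1 ρ σ = QDiv.trPosPart (ρ - σ) ∧
    -- the inequalities for `0 < α < 1`, where the integral defining `H_α` converges
    (∀ α ∈ Set.Ioo (0 : ℝ) 1,
      MeasureTheory.IntegrableOn (QDiv.fDivIntegrand (QDiv.hellingerFun α) ρ σ) (Set.Ioi 1) ∧
      (1 - α) * QDiv.petzHellinger α ρ σ ≤ (1 - α) * QDiv.hellinger α ρ σ ∧
      (1 - α) * QDiv.hellinger α ρ σ ≤ QDiv.hockeyStick 1 ρ σ) ∧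
    -- the endpoints `α = 0` and `α = 1`, both quantities being extended by continuity
    (∀ α : ℝ, α = 0 ∨ α = 1 →
      ∃ h : ℝ,
        Filter.Tendsto (fun β => (1 - β) * QDiv.petzHellinger β ρ σ) (𝓝[Set.Ioo 0 1] α)
          (𝓝 (1 - QDiv.petzTrace α ρ σ)) ∧
        Filter.Tendsto (fun β => (1 - β) * QDiv.hellinger β ρ σ) (𝓝[Set.Ioo 0 1] α) (𝓝 h) ∧
        1 - QDiv.petzTrace α ρ σ ≤ h ∧ h ≤ QDiv.hockeyStick 1 ρ σ) ∧
    -- the inequality of Audenaert et al., with the sharper intermediate bound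
    (∀ α ∈ Set.Ioo (0 : ℝ) 1,
      QDiv.errorProb ρ σ ≤ 1 - (1 - α) * QDiv.hellinger α ρ σ ∧
      1 - (1 - α) * QDiv.hellinger α ρ σ ≤ QDiv.petzTrace α ρ σ) ∧
    (∀ α ∈ Set.Icc (0 : ℝ) 1, QDiv.errorProb ρ σ ≤ QDiv.petzTrace α ρ σ) ∧
    -- the minimum in the definition of `C(ρ, σ)` is attained
    (∃ α ∈ Set.Icc (0 : ℝ) 1, QDiv.chernoff ρ σ = -QDiv.elog (QDiv.petzTrace α ρ σ)) ∧
    -- achievability of the quantum Chernoff bound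
    (∀ n : ℕ, 1 ≤ n →
      QDiv.chernoff ρ σ ≤
        -(QDiv.elog (QDiv.errorProb (QDiv.tensorPow n ρ) (QDiv.tensorPow n σ)) /
          (n : EReal))) := by
  refine ⟨by rw [QDiv.hockeyStick, Complex.ofReal_one, one_smul], fun α hα => ⟨?_, ?_, ?_⟩,
    fun α hα => ?_, fun α hα => ⟨?_, ?_⟩, fun α hα => QDiv.errorProb_le_petzTrace hρ hσ hα,
    QDiv.exists_chernoff_eq hρ.posSemidef hσ.posSemidef, fun n hn => QDiv.chernoff_le hρ hσ hn⟩
  · exact QDiv.integrableOn_fDivIntegrand hρ.posSemidef hσ.posSemidef hα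
  · rw [QDiv.one_sub_mul_petzHellinger ρ σ hα.2.ne]
    linarith [QDiv.one_sub_hellinger_le_petzTrace hρ hσ hα]
  · exact QDiv.hellinger_le hρ hσ hα
  · obtain ⟨h, hh, h1, h2⟩ := QDiv.exists_tendsto_hellinger hρ hσ hα
    exact ⟨h, QDiv.tendsto_one_sub_mul_petzHellinger hρ.posSemidef hσ.posSemidef α, hh, h1, h2⟩
  · rw [QDiv.errorProb_eq hρ hσ]
    linarith [QDiv.hellinger_le hρ hσ hα]
  · exact QDiv.one_sub_hellinger_le_petzTrace hρ hσ hα
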